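/- Let $\mathcal A$ be a unital C*-algebra. A state is a positive linear functional $\omega$ on $\mathcal A$ with $\omega(\mathbb 1)=1$; pure states are the extreme points of the set of states. Let $\rho=(\rho_t)_{t\in\mathbb R}$ be a strongly continuous one-parameter group of $*$-automorphisms of $\mathcal A$, with generator $\delta^\rho(a)=\lim_{t\to0^+}\frac1t(\rho_t(a)-a)$ on the domain $\mathcal D(\delta^\rho)$ of all $a\in\mathcal A$ for which the limit exists in norm. For a unitary $u$ write $\mathrm{Ad}_u(a)=u^*au$. A pair $(\omega_1,\omega_2)$ of pure states is $\rho$-locally-comparable if $\omega_2=\omega_1\circ\mathrm{Ad}_u$ for some unitary $u\in\mathcal D(\delta^\rho)$, and a state $\omega$ is $\rho$-invariant if $\omega\circ\rho_t=\omega$ for all $t$. Call $(\omega_1,\omega_2)$ $\rho$-admissible if it is a $\rho$-locally-comparable pair of pure states, both $\rho$-invariant; in that case put $$\mathcal N_\rho(\omega_1,\omega_2)=i\,\omega_1\bigl(u^*\delta^\rho(u)\bigr),$$ where $u\in\mathcal D(\delta^\rho)$ is a unitary with $\omega_2=\omega_1\circ\mathrm{Ad}_u$. Then: (i) for $\rho$-admissible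 $(\omega_1,\omega_2)$, $\mathcal N_\rho(\omega_1,\omega_2)$ does not depend on the choice of the unitary $u\in\mathcal D(\delta^\rho)$ with $\omega_2=\omega_1\circ\mathrm{Ad}_u$; (ii) if $\rho_{2\pi}=\mathrm{id}$, then $\mathcal N_\rho(\omega_1,\omega_2)\in\mathbb Z$ for every $\rho$-admissible pair; (iii) if $(\omega_1,\omega_2)$ is $\rho$-admissible and $\|\omega_1-\omega_2\|<2$ (norm of the dual of $\mathcal A$), then $\mathcal N_\rho(\omega_1,\omega_2)=0$; (iv) if $\alpha$ is a $*$-automorphism of $\mathcal A$ with $\alpha\circ\delta^\rho=\delta^\rho\circ\alpha$ (as unbounded operators, including equality of domains) and $(\omega_1,\omega_2)$ is $\rho$-admissible, then so is $(\omega_1\circ\alpha,\omega_2\circ\alpha)$, and $\mathcal N_\rho(\omega_1\circ\alpha,\omega_2\circ\alpha)=\mathcal N_\rho(\omega_1,\omega_2)$; (v) for every $\rho$-invariant pure state $\omega$, $(\omega,\omega)$ is $\rho$-admissible and $\mathcal N_\rho(\omega,\omega)=0$; (vi) if $(\omega_1,\omega_2)$ and $(\omega_2,\omega_3)$ are $\rho$-admissible,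 then so is $(\omega_1,\omega_3)$, and $\mathcal N_\rho(\omega_1,\omega_2)+\mathcal N_\rho(\omega_2,\omega_3)=\mathcal N_\rho(\omega_1,\omega_3)$; (vii) if $(\omega_1,\omega_2)$ is $\rho$-admissible, then so is $(\omega_2,\omega_1)$, and $\mathcal N_\rho(\omega_1,\omega_2)=-\mathcal N_\rho(\omega_2,\omega_1)$; (viii) let $\widetilde{\mathcal A}$ be another unital C*-algebra with a strongly continuous one-parameter group $\widetilde\rho$ of $*$-automorphisms, let $(\omega_1,\omega_2)$ be $\rho$-admissible and $(\widetilde\omega_1,\widetilde\omega_2)$ be $\widetilde\rho$-admissible. Let $\mathcal C$ be a unital C*-algebra with a unital $*$-homomorphism of dense range from the algebraic tensor product $\mathcal A\odot\widetilde{\mathcal A}$ into $\mathcal C$ (for instance the completion in a C*-norm), and denote by $a\otimes b$ also the image in $\mathcal C$. Suppose that $\rho\otimes\widetilde\rho$ is a strongly continuous one-parameter group of $*$-automorphisms of $\mathcal C$ with $(\rho\otimes\widetilde\rho)_t(a\otimes b)=\rho_t(a)\otimes\widetilde\rho_t(b)$ and that $\omega_k\otimes\widetilde\omega_k$ ($k=1,2$)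 are states of $\mathcal C$ with $(\omega_k\otimes\widetilde\omega_k)(a\otimes b)=\omega_k(a)\,\widetilde\omega_k(b)$. Then $(\omega_1\otimes\widetilde\omega_1,\omega_2\otimes\widetilde\omega_2)$ is $\rho\otimes\widetilde\rho$-admissible and $$\mathcal N_{\rho\otimes\widetilde\rho}(\omega_1\otimes\widetilde\omega_1,\omega_2\otimes\widetilde\omega_2)=\mathcal N_\rho(\omega_1,\omega_2)+\mathcal N_{\widetilde\rho}(\widetilde\omega_1,\widetilde\omega_2).$$ This applies in particular to the spatial (minimal) C*-tensor product of $\mathcal A$ and $\widetilde{\mathcal A}$, in which the image of $\mathcal A\odot\widetilde{\mathcal A}$ is dense and on which the product group $\rho\otimes\widetilde\rho$ and the product state of any state of $\mathcal A$ with any state of $\widetilde{\mathcal A}$ exist and are unique. -/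

import Mathlib

open scoped ComplexOrder TensorProduct ENNReal Topology InnerProductSpace

universe u v w

noncomputable section

namespace ChargeIndex

/-! ### States, one-parameter automorphism groups and their generators -/

section Basic

/-- The states of a unital C⋆-algebra: positive normalized functionals, as a subset of the Banach
dual (positive functionals on a C⋆-algebra are automatically bounded). -/
def stateSpace (A : Type*) [CStarAlgebra A] : Set (StrongDual ℂ A) :=
  {ω | (∀ a : A, 0 ≤ ω (star a * a)) ∧ ω 1 = 1}

/-- The pure states: extreme points of the state space. -/
def pureStates (A : Type*) [CStarAlgebra A] : Set (StrongDual ℂ A) :=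
  (stateSpace A).extremePoints ℝ

/-- A strongly continuous one-parameter group of ⋆-automorphisms of `A`. -/
structure AutFlow (A : Type*) [CStarAlgebra A] where
  /-- the automorphism at time `t` -/
  toFun : ℝ → (A ≃⋆ₐ[ℂ] A)
  map_zero : ∀ a : A, toFun 0 a = a
  map_add : ∀ (s t : ℝ) (a : A), toFun (s + t) a = toFun s (toFun t a)
  continuous : ∀ a : A, Continuous fun t : ℝ => toFun t a

variable {A : Type*} [CStarAlgebra A]

/-- `b` is the right derivative at `0` of `t ↦ ρ_t(a)`. -/
def AutFlow.HasGenerator (ρ : AutFlow A) (a b : A) : Prop :=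
  Filter.Tendsto (fun t : ℝ => ((t⁻¹ : ℝ) : ℂ) • (ρ.toFun t a - a)) (𝓝[>] (0 : ℝ)) (𝓝 b)

/-- The domain of the generator: all `a` for which `lim_{t → 0⁺} (ρ_t(a) - a) / t` exists. -/
def AutFlow.domain (ρ : AutFlow A) : Submodule ℂ A where
  carrier := {a | ∃ b, ρ.HasGenerator a b}
  zero_mem' := ⟨0, by simp [AutFlow.HasGenerator]⟩
  add_mem' := by
    rintro a a' ⟨b, hb⟩ ⟨b', hb'⟩
    refine ⟨b + b', (Filter.Tendsto.add hb hb').congr fun t => ?_⟩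
    rw [← smul_add, _root_.map_add]
    congr 1
    abel
  smul_mem' := by
    rintro c a ⟨b, hb⟩
    refine ⟨c • b, (Filter.Tendsto.const_smul hb c).congr fun t => ?_⟩
    rw [map_smul, smul_comm, smul_sub]

/-- The generator `δ^ρ`, a densely defined, in general unbounded, operator on `A`. -/
def AutFlow.generator (ρ : AutFlow A) : A →ₗ.[ℂ] A where
  domain := ρ.domain
  toFun :=
    { toFun := fun a => a.2.choose
      map_add' := fun a a' => by
        refine tendsto_nhds_unique (a + a').2.choose_spec
          ((Filter.Tendsto.add a.2.choose_spec a'.2.choose_spec).congr fun t => ?_)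
        rw [← smul_add, Submodule.coe_add, _root_.map_add]
        congr 1
        abel
      map_smul' := fun c a => by
        refine tendsto_nhds_unique (c • a).2.choose_spec
          ((Filter.Tendsto.const_smul a.2.choose_spec c).congr fun t => ?_)
        rw [Submodule.coe_smul, map_smul, smul_comm, smul_sub] }

/-- `ω ∘ ρ_t = ω` for all `t`. -/
def IsInvariant (ρ : AutFlow A) (ω : StrongDual ℂ A) : Prop :=
  ∀ (t : ℝ) (a : A), ω (ρ.toFun t a) = ω a

/-- `u ∈ 𝒰(A) ∩ 𝒟(δ^ρ)` and `ω₂ = ω₁ ∘ Ad_u`, where `Ad_u(a) = u⋆ a u`. -/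
structure Intertwines (ρ : AutFlow A) (ω₁ ω₂ : StrongDual ℂ A) (u : A) : Prop where
  unitary : u ∈ unitary A
  mem_domain : u ∈ ρ.generator.domain
  eq_comp : ∀ a : A, ω₂ a = ω₁ (star u * a * u)

/-- `(ω₁, ω₂)` is a `ρ`-locally-comparable pair of pure states. -/
def LocallyComparable (ρ : AutFlow A) (ω₁ ω₂ : StrongDual ℂ A) : Prop :=
  ω₁ ∈ pureStates A ∧ ω₂ ∈ pureStates A ∧ ∃ u : A, Intertwines ρ ω₁ ω₂ u

/-- The pairs for which the index is defined: `ρ`-locally-comparable pairs of pure states, both of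
which are `ρ`-invariant. -/
structure Admissible (ρ : AutFlow A) (ω₁ ω₂ : StrongDual ℂ A) : Prop where
  comparable : LocallyComparable ρ ω₁ ω₂
  invariant_left : IsInvariant ρ ω₁
  invariant_right : IsInvariant ρ ω₂

/-- The number `i ω₁(u⋆ δ^ρ(u))` for a given `u` in the domain of `δ^ρ`. -/
def indexValue (ρ : AutFlow A) (ω₁ : StrongDual ℂ A) (u : ρ.generator.domain) : ℂ :=
  Complex.I * ω₁ (star (u : A) * ρ.generator u)

open Classical in
/-- The index `𝒩_ρ(ω₁, ω₂) = i ω₁(u⋆ δ^ρ(u))`, for some intertwining unitary `u` in the domain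
of `δ^ρ` (and `0` if there is none). -/
def index (ρ : AutFlow A) (ω₁ ω₂ : StrongDual ℂ A) : ℂ :=
  if h : ∃ u : A, Intertwines ρ ω₁ ω₂ u then
    indexValue ρ ω₁ ⟨h.choose, h.choose_spec.mem_domain⟩
  else 0

/-- The functional `ω ∘ α` for a ⋆-automorphism `α`. -/
def pullback (ω : StrongDual ℂ A) (α : A ≃⋆ₐ[ℂ] A) : StrongDual ℂ A :=
  ω.comp
    ({ toFun := α
       map_add' := map_add α
       map_smul' := map_smul α
       cont := (NonUnitalStarAlgHom.isometry α (EquivLike.injective α)).continuous } : A →L[ℂ] A)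

/-- `α ∘ δ^ρ = δ^ρ ∘ α` as unbounded operators, domains included. -/
def CommutesWithGenerator (ρ : AutFlow A) (α : A ≃⋆ₐ[ℂ] A) : Prop :=
  (∀ a : A, α a ∈ ρ.generator.domain ↔ a ∈ ρ.generator.domain) ∧
    ∀ (a : A) (ha : a ∈ ρ.generator.domain) (hα : α a ∈ ρ.generator.domain),
      α (ρ.generator ⟨a, ha⟩) = ρ.generator ⟨α a, hα⟩

end Basic

/-! ### Product flows and product states

Here `j : A ⊗ B → C` is a ⋆-homomorphism from the algebraic tensor product into a C⋆-algebra. -/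

section Product

variable {A B C : Type*} [CStarAlgebra A] [CStarAlgebra B] [CStarAlgebra C]

/-- `σ = ρ ⊗ ρ'`, that is `σ_t(a ⊗ b) = ρ_t(a) ⊗ ρ'_t(b)`. -/
def IsProductFlow (j : A ⊗[ℂ] B →⋆ₐ[ℂ] C) (ρ : AutFlow A) (ρ' : AutFlow B) (σ : AutFlow C) : Prop :=
  ∀ (t : ℝ) (a : A) (b : B), σ.toFun t (j (a ⊗ₜ[ℂ] b)) = j (ρ.toFun t a ⊗ₜ[ℂ] ρ'.toFun t b)

/-- `Ω = ω ⊗ ω'`, that is `Ω` is a state with `Ω(a ⊗ b) = ω(a) ω'(b)`. -/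
def IsProductState (j : A ⊗[ℂ] B →⋆ₐ[ℂ] C) (ω : StrongDual ℂ A) (ω' : StrongDual ℂ B)
    (Ω : StrongDual ℂ C) : Prop :=
  Ω ∈ stateSpace C ∧ ∀ (a : A) (b : B), Ω (j (a ⊗ₜ[ℂ] b)) = ω a * ω' b

end Product

/-! ### Tensor products of representations on Hilbert spaces -/

section TensorRep

open UniformSpace (Completion)

/-- The Hilbert space tensor product. -/
def HilbertTensor (H K : Type*) [NormedAddCommGroup H] [InnerProductSpace ℂ H]
    [NormedAddCommGroup K] [InnerProductSpace ℂ K] : Type _ :=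
  Completion (H ⊗[ℂ] K)

section

variable {H K : Type*} [NormedAddCommGroup H] [InnerProductSpace ℂ H]
  [NormedAddCommGroup K] [InnerProductSpace ℂ K]

instance : NormedAddCommGroup (HilbertTensor H K) :=
  inferInstanceAs (NormedAddCommGroup (Completion (H ⊗[ℂ] K)))

instance : InnerProductSpace ℂ (HilbertTensor H K) :=
  inferInstanceAs (InnerProductSpace ℂ (Completion (H ⊗[ℂ] K)))

instance : CompleteSpace (HilbertTensor H K) :=
  inferInstanceAs (CompleteSpace (Completion (H ⊗[ℂ] K)))

/-- The inclusion of the algebraic tensor product. -/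
def inclHT : H ⊗[ℂ] K →ₗᵢ[ℂ] HilbertTensor H K := Completion.toComplₗᵢ

lemma denseRange_inclHT : DenseRange (inclHT : H ⊗[ℂ] K →ₗᵢ[ℂ] HilbertTensor H K) :=
  Completion.denseRange_coe

/-- The bounded operator `S ⊗ T` on the Hilbert space tensor product. -/
def tensorOp (S : H →L[ℂ] H) (T : K →L[ℂ] K) : HilbertTensor H K →L[ℂ] HilbertTensor H K :=
  ((TensorProduct.mapL S T).completion : Completion (H ⊗[ℂ] K) →L[ℂ] Completion (H ⊗[ℂ] K))

lemma tensorOp_incl (S : H →L[ℂ] H) (T : K →L[ℂ] K) (x : H ⊗[ℂ] K) :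
    tensorOp S T (inclHT x) = inclHT (TensorProduct.mapL S T x) :=
  ContinuousLinearMap.completion_apply_coe (TensorProduct.mapL S T) x

lemma tensorOp_ext {S T : HilbertTensor H K →L[ℂ] HilbertTensor H K}
    (h : ∀ x : H ⊗[ℂ] K, S (inclHT x) = T (inclHT x)) : S = T :=
  ContinuousLinearMap.ext fun x =>
    congrFun (denseRange_inclHT.equalizer S.continuous T.continuous (funext h)) x

lemma norm_tensorOp_le (S : H →L[ℂ] H) (T : K →L[ℂ] K) : ‖tensorOp S T‖ ≤ ‖S‖ * ‖T‖ := by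
  refine ContinuousLinearMap.opNorm_le_bound _ (by positivity) fun x => ?_
  refine denseRange_inclHT.induction_on x (isClosed_le (by fun_prop) (by fun_prop)) fun x => ?_
  · rw [tensorOp_incl, LinearIsometry.norm_map, LinearIsometry.norm_map]
    exact (ContinuousLinearMap.le_opNorm _ _).trans
      (mul_le_mul_of_nonneg_right (TensorProduct.norm_mapL_le _ _) (norm_nonneg _))

lemma tensorOp_add_left (S S' : H →L[ℂ] H) (T : K →L[ℂ] K) :
    tensorOp (S + S') T = tensorOp S T + tensorOp S' T :=
  tensorOp_ext fun x => by
    rw [add_apply, tensorOp_incl, tensorOp_incl, tensorOp_incl, TensorProduct.mapL_add_left,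
      add_apply, map_add]

lemma tensorOp_add_right (S : H →L[ℂ] H) (T T' : K →L[ℂ] K) :
    tensorOp S (T + T') = tensorOp S T + tensorOp S T' :=
  tensorOp_ext fun x => by
    rw [add_apply, tensorOp_incl, tensorOp_incl, tensorOp_incl, TensorProduct.mapL_add_right,
      add_apply, map_add]

lemma tensorOp_smul_left (c : ℂ) (S : H →L[ℂ] H) (T : K →L[ℂ] K) :
    tensorOp (c • S) T = c • tensorOp S T :=
  tensorOp_ext fun x => by
    rw [smul_apply, tensorOp_incl, tensorOp_incl, TensorProduct.mapL_smul_left, smul_apply,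
      map_smul]

lemma tensorOp_smul_right (c : ℂ) (S : H →L[ℂ] H) (T : K →L[ℂ] K) :
    tensorOp S (c • T) = c • tensorOp S T :=
  tensorOp_ext fun x => by
    rw [smul_apply, tensorOp_incl, tensorOp_incl, TensorProduct.mapL_smul_right, smul_apply,
      map_smul]

lemma tensorOp_mul (S S' : H →L[ℂ] H) (T T' : K →L[ℂ] K) :
    tensorOp (S * S') (T * T') = tensorOp S T * tensorOp S' T' :=
  tensorOp_ext fun x => by
    rw [mul_apply_eq_comp, tensorOp_incl, tensorOp_incl, tensorOp_incl,
      TensorProduct.mapL_mul, mul_apply_eq_comp]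

lemma tensorOp_one : tensorOp (1 : H →L[ℂ] H) (1 : K →L[ℂ] K) = 1 :=
  tensorOp_ext fun x => by
    rw [tensorOp_incl]
    simp

end

variable {H K : Type*} [NormedAddCommGroup H] [InnerProductSpace ℂ H] [CompleteSpace H]
  [NormedAddCommGroup K] [InnerProductSpace ℂ K] [CompleteSpace K]

lemma inner_mapL_adjoint (S : H →L[ℂ] H) (T : K →L[ℂ] K)
    (x y : H ⊗[ℂ] K) :
    ⟪TensorProduct.mapL (star S) (star T) x, y⟫_ℂ = ⟪x, TensorProduct.mapL S T y⟫_ℂ := by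
  induction x with
  | zero => simp
  | add x x' hx hx' => rw [map_add, inner_add_left, inner_add_left, hx, hx']
  | tmul x x' =>
    induction y with
    | zero => simp
    | add y y' hy hy' => rw [map_add, inner_add_right, inner_add_right, hy, hy']
    | tmul y y' =>
      rw [TensorProduct.mapL_tmul, TensorProduct.mapL_tmul, TensorProduct.inner_tmul,
        TensorProduct.inner_tmul, ContinuousLinearMap.star_eq_adjoint,
        ContinuousLinearMap.star_eq_adjoint, ContinuousLinearMap.adjoint_inner_left,
        ContinuousLinearMap.adjoint_inner_left]

lemma tensorOp_star (S : H →L[ℂ] H) (T : K →L[ℂ] K) :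
    tensorOp (star S) (star T) = star (tensorOp S T) := by
  rw [ContinuousLinearMap.star_eq_adjoint (tensorOp S T), ContinuousLinearMap.eq_adjoint_iff]
  intro x y
  refine denseRange_inclHT.induction_on x (isClosed_eq (by fun_prop) (by fun_prop)) fun x => ?_
  refine denseRange_inclHT.induction_on y (isClosed_eq (by fun_prop) (by fun_prop)) fun y => ?_
  rw [tensorOp_incl, tensorOp_incl, LinearIsometry.inner_map_map, LinearIsometry.inner_map_map,
    inner_mapL_adjoint]

variable {A B : Type*} [CStarAlgebra A] [CStarAlgebra B]

/-- The linear map `a ⊗ b ↦ π(a) ⊗ π'(b)`. -/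
def tensorRepLin (π : A →⋆ₐ[ℂ] (H →L[ℂ] H)) (π' : B →⋆ₐ[ℂ] (K →L[ℂ] K)) :
    A ⊗[ℂ] B →ₗ[ℂ] (HilbertTensor H K →L[ℂ] HilbertTensor H K) :=
  TensorProduct.lift <| LinearMap.mk₂ ℂ (fun a b => tensorOp (π a) (π' b))
    (fun a a' b => by rw [map_add, tensorOp_add_left])
    (fun c a b => by rw [map_smul, tensorOp_smul_left])
    (fun a b b' => by rw [map_add, tensorOp_add_right])
    (fun c a b => by rw [map_smul, tensorOp_smul_right])

lemma tensorRepLin_tmul (π : A →⋆ₐ[ℂ] (H →L[ℂ] H)) (π' : B →⋆ₐ[ℂ] (K →L[ℂ] K)) (a : A) (b : B) :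
    tensorRepLin π π' (a ⊗ₜ[ℂ] b) = tensorOp (π a) (π' b) := rfl

/-- The representation `π ⊗ π'` of the algebraic tensor product. -/
def tensorRep (π : A →⋆ₐ[ℂ] (H →L[ℂ] H)) (π' : B →⋆ₐ[ℂ] (K →L[ℂ] K)) :
    A ⊗[ℂ] B →⋆ₐ[ℂ] (HilbertTensor H K →L[ℂ] HilbertTensor H K) where
  __ := Algebra.TensorProduct.algHomOfLinearMapTensorProduct (tensorRepLin π π')
    (fun a a' b b' => by
      rw [tensorRepLin_tmul, tensorRepLin_tmul, tensorRepLin_tmul, map_mul, map_mul, tensorOp_mul])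
    (by rw [tensorRepLin_tmul, map_one, map_one, tensorOp_one])
  map_star' x := by
    change tensorRepLin π π' (star x) = star (tensorRepLin π π' x)
    induction x with
    | zero => rw [star_zero, map_zero, star_zero]
    | add x y hx hy => rw [star_add, map_add, map_add, star_add, hx, hy]
    | tmul a b =>
      rw [TensorProduct.star_tmul, tensorRepLin_tmul, tensorRepLin_tmul, map_star, map_star,
        tensorOp_star]

lemma tensorRep_tmul (π : A →⋆ₐ[ℂ] (H →L[ℂ] H)) (π' : B →⋆ₐ[ℂ] (K →L[ℂ] K)) (a : A) (b : B) :
    tensorRep π π' (a ⊗ₜ[ℂ] b) = tensorOp (π a) (π' b) := rfl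

lemma norm_tensorRep_tmul_le (π : A →⋆ₐ[ℂ] (H →L[ℂ] H)) (π' : B →⋆ₐ[ℂ] (K →L[ℂ] K)) (a : A)
    (b : B) : ‖tensorRep π π' (a ⊗ₜ[ℂ] b)‖ ≤ ‖a‖ * ‖b‖ := by
  rw [tensorRep_tmul]
  refine (norm_tensorOp_le _ _).trans ?_
  gcongr
  · exact NonUnitalStarAlgHom.norm_apply_le π a
  · exact NonUnitalStarAlgHom.norm_apply_le π' b

end TensorRep

/-! ### Direct sums of bounded families of representations -/

section DirectSum

variable {I : Type*} {D : I → Type*} [∀ i, CStarAlgebra (D i)] [∀ i, Nontrivial (D i)]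

instance : CStarAlgebra (lp D ∞) where

/-- The direct sum of a pointwise bounded family of ⋆-homomorphisms. -/
def lpRep {X : Type*} [Semiring X] [Algebra ℂ X] [Star X] (π : ∀ i, X →⋆ₐ[ℂ] D i)
    (hπ : ∀ x, ∃ M : ℝ, ∀ i, ‖π i x‖ ≤ M) : X →⋆ₐ[ℂ] lp D ∞ where
  toFun x := ⟨fun i => π i x, memℓp_infty (by
    obtain ⟨M, hM⟩ := hπ x
    exact ⟨M, by rintro _ ⟨i, rfl⟩; exact hM i⟩)⟩
  map_one' := by ext i; exact map_one (π i)
  map_mul' x y := by ext i; exact map_mul (π i) x y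
  map_zero' := by ext i; exact map_zero (π i)
  map_add' x y := by ext i; exact map_add (π i) x y
  commutes' c := by ext i; exact AlgHomClass.commutes (π i) c
  map_star' x := by ext i; exact map_star (π i) x

end DirectSum

/-! ### The spatial (minimal) C⋆-tensor product

It is the closure of the image of the algebraic tensor product `A ⊗ B` under the direct sum, over
all pairs of states `(φ, ψ)`, of the representations `π_φ ⊗ π_ψ` on the Hilbert space tensor
products `H_φ ⊗ H_ψ` of the GNS spaces. -/

section Spatial

attribute [local instance 10] CStarAlgebra.spectralOrder CStarAlgebra.spectralOrderedRing

variable {A B : Type*} [CStarAlgebra A] [CStarAlgebra B]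

/-- A state as a positive linear map. -/
def stateMap (φ : stateSpace A) : A →ₚ[ℂ] ℂ :=
  PositiveLinearMap.mk₀ (φ : StrongDual ℂ A).toLinearMap fun x hx => by
    obtain ⟨y, rfl⟩ := CStarAlgebra.nonneg_iff_eq_star_mul_self.mp hx
    exact φ.2.1 y

/-- The GNS Hilbert space of a state. -/
def gnsSpace (φ : stateSpace A) : Type _ := (stateMap φ).GNS

instance (φ : stateSpace A) : NormedAddCommGroup (gnsSpace φ) :=
  inferInstanceAs (NormedAddCommGroup (stateMap φ).GNS)

instance (φ : stateSpace A) : InnerProductSpace ℂ (gnsSpace φ) :=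
  inferInstanceAs (InnerProductSpace ℂ (stateMap φ).GNS)

instance (φ : stateSpace A) : CompleteSpace (gnsSpace φ) :=
  inferInstanceAs (CompleteSpace (stateMap φ).GNS)

/-- The GNS representation of a state. -/
def gnsRep (φ : stateSpace A) : A →⋆ₐ[ℂ] (gnsSpace φ →L[ℂ] gnsSpace φ) :=
  (stateMap φ).gnsStarAlgHom

/-- The GNS vector of a state. -/
def gnsVector (φ : stateSpace A) : gnsSpace φ :=
  (((stateMap φ).toPreGNS 1 : (stateMap φ).PreGNS) : (stateMap φ).GNS)

lemma norm_gnsVector (φ : stateSpace A) : ‖gnsVector φ‖ = 1 := by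
  have h : stateMap φ 1 = 1 := φ.2.2
  refine (UniformSpace.Completion.norm_coe _).trans ?_
  rw [PositiveLinearMap.preGNS_norm_def]
  simp [h]

/-- The Hilbert space `H_φ ⊗ H_ψ`. -/
abbrev prodSpace (p : stateSpace A × stateSpace B) : Type _ :=
  HilbertTensor (gnsSpace p.1) (gnsSpace p.2)

instance (p : stateSpace A × stateSpace B) : Nontrivial (prodSpace p) := by
  refine ⟨inclHT (gnsVector p.1 ⊗ₜ[ℂ] gnsVector p.2), 0, fun h => ?_⟩
  have := congrArg norm h
  rw [LinearIsometry.norm_map, TensorProduct.norm_tmul, norm_gnsVector,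
    norm_gnsVector] at this
  simp at this

/-- The representation `π_φ ⊗ π_ψ` of the algebraic tensor product. -/
def prodRep (p : stateSpace A × stateSpace B) :
    A ⊗[ℂ] B →⋆ₐ[ℂ] (prodSpace p →L[ℂ] prodSpace p) :=
  tensorRep (gnsRep p.1) (gnsRep p.2)

lemma exists_norm_prodRep_le (x : A ⊗[ℂ] B) :
    ∃ M : ℝ, ∀ p : stateSpace A × stateSpace B, ‖prodRep p x‖ ≤ M := by
  induction x with
  | zero => exact ⟨0, fun p => by rw [map_zero, norm_zero]⟩
  | tmul a b => exact ⟨‖a‖ * ‖b‖, fun p => norm_tensorRep_tmul_le _ _ a b⟩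
  | add x y hx hy =>
    obtain ⟨M, hM⟩ := hx
    obtain ⟨L, hL⟩ := hy
    exact ⟨M + L, fun p => by
      rw [map_add]
      exact (norm_add_le _ _).trans (add_le_add (hM p) (hL p))⟩

variable (A B) in
/-- Bounded families of operators, one on each `H_φ ⊗ H_ψ`: the block diagonal operators on the
direct sum of these Hilbert spaces. -/
abbrev BlockOps : Type _ :=
  lp (fun p : stateSpace A × stateSpace B => prodSpace p →L[ℂ] prodSpace p) ∞

variable (A B) in
/-- The direct sum of the representations `π_φ ⊗ π_ψ` of the algebraic tensor product. -/
def blockRep : A ⊗[ℂ] B →⋆ₐ[ℂ] BlockOps A B :=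
  lpRep prodRep exists_norm_prodRep_le

variable (A B) in
/-- The spatial (minimal) C⋆-tensor product of `A` and `B`. -/
def SpatialTensor : Type _ := (blockRep A B).range.topologicalClosure

instance : CStarAlgebra (SpatialTensor A B) :=
  StarSubalgebra.cstarAlgebra (blockRep A B).range.topologicalClosure
    (h_closed := StarSubalgebra.isClosed_topologicalClosure (blockRep A B).range)

variable (A B) in
/-- The canonical map of the algebraic tensor product into the spatial tensor product. -/
def spatialEmb : A ⊗[ℂ] B →⋆ₐ[ℂ] SpatialTensor A B :=
  (StarSubalgebra.inclusion (StarSubalgebra.le_topologicalClosure _)).comp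
    (blockRep A B).rangeRestrict

end Spatial

end ChargeIndex

end

/-!
Differentiating `t ↦ ρ_t(u)` turns `ω₁(u⋆ δ(u))` into the logarithmic derivative at `0` of
`t ↦ ω₁(w_t)`, where `w_t = u⋆ ρ_t(u)`. Invariance of `ω₁` and `ω₂` says that `Ad_{w_t}` fixes `ω₁`,
and a pure state fixed by `Ad_w` is multiplicative against `w`, that is `ω(a w) = ω(w) ω(a)`: the
vector of `w` in the GNS representation is a multiple of the cyclic vector, because the commutant of
that representation is trivial. Hence `t ↦ ω₁(w_t)` is a character of `ℝ`, which makes the index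
integral as soon as `ρ_{2π} = id`. The same multiplicativity shows that two choices of `u` differ by
a unitary which contributes nothing, and the algebraic properties of the index then follow from the
Leibniz rule.

If `ω₁(u) ≠ 0`, evaluating `u w_t = ρ_t(u)` in the invariant state `ω₁` forces `ω₁(w_t) = 1`, so
that the index vanishes. If `ω₁(u) = 0`, the vectors of `1` and `u` in the GNS representation are
orthogonal; by irreducibility an element `0 ≤ e ≤ 1` nearly separates the two states, and these are
at distance `2`.

For tensor products, the point is that a product of pure states is pure: a functional dominated by
the product state restricts, in each tensor factor, to a multiple of the pure state on that factor.
-/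

noncomputable section

namespace ChargeIndex

open scoped CStarAlgebra

/-- A ⋆-homomorphism between C⋆-algebras, regarded as a bounded linear map. -/
def starHomCLM {A B F : Type*} [CStarAlgebra A] [CStarAlgebra B] [FunLike F A B]
    [NonUnitalAlgHomClass F ℂ A B] [StarHomClass F A B] (f : F) : A →L[ℂ] B :=
  ⟨f, map_continuous f⟩

/-! ### The generator of a flow -/

section Flow

variable {A : Type*} [CStarAlgebra A]

namespace AutFlow

variable {ρ : AutFlow A} {a b a' b' : A}

lemma ext_apply {σ τ : AutFlow A} (h : ∀ t a, σ.toFun t a = τ.toFun t a) : σ = τ := by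
  cases σ; cases τ
  congr
  exact funext fun t => StarAlgEquiv.ext (h t)

lemma apply_neg_apply (ρ : AutFlow A) (t : ℝ) (a : A) : ρ.toFun t (ρ.toFun (-t) a) = a := by
  rw [← ρ.map_add, add_neg_cancel, ρ.map_zero]

lemma hasGenerator_iff :
    ρ.HasGenerator a b ↔ HasDerivWithinAt (fun t => ρ.toFun t a) b (Set.Ioi 0) 0 := by
  rw [hasDerivWithinAt_iff_tendsto_slope' (by simp), HasGenerator]
  refine Filter.tendsto_congr fun t => ?_
  rw [slope_def_module, sub_zero, ρ.map_zero, Complex.coe_smul]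

lemma HasGenerator.mem_domain (h : ρ.HasGenerator a b) : a ∈ ρ.generator.domain :=
  ⟨b, h⟩

lemma hasGenerator_generator (ha : a ∈ ρ.generator.domain) :
    ρ.HasGenerator a (ρ.generator ⟨a, ha⟩) :=
  Exists.choose_spec (p := fun b => ρ.HasGenerator a b) ha

lemma HasGenerator.generator_eq (h : ρ.HasGenerator a b) :
    ρ.generator ⟨a, h.mem_domain⟩ = b :=
  tendsto_nhds_unique (hasGenerator_generator h.mem_domain) h

lemma hasGenerator_one : ρ.HasGenerator 1 0 := by
  rw [hasGenerator_iff]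
  simpa only [map_one] using hasDerivWithinAt_const (0 : ℝ) (Set.Ioi 0) (1 : A)

lemma HasGenerator.mul (h : ρ.HasGenerator a b) (h' : ρ.HasGenerator a' b') :
    ρ.HasGenerator (a * a') (b * a' + a * b') := by
  rw [hasGenerator_iff] at *
  simpa only [Pi.mul_def, map_mul, ρ.map_zero] using HasDerivWithinAt.mul h h'

lemma HasGenerator.star (h : ρ.HasGenerator a b) : ρ.HasGenerator (star a) (star b) := by
  rw [hasGenerator_iff] at *
  simpa only [map_star] using HasDerivWithinAt.star h

lemma HasGenerator.apply (h : ρ.HasGenerator a b) (s : ℝ) :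
    ρ.HasGenerator (ρ.toFun s a) (ρ.toFun s b) := by
  refine (((starHomCLM (ρ.toFun s)).continuous.tendsto b).comp h).congr fun t => ?_
  change ρ.toFun s _ = _
  rw [map_smul, map_sub, ← ρ.map_add, ← ρ.map_add, add_comm]

lemma HasGenerator.hasDerivWithinAt (h : ρ.HasGenerator a b) (s : ℝ) :
    HasDerivWithinAt (fun t => ρ.toFun t a) (ρ.toFun s b) (Set.Ioi s) s := by
  have hshift : HasDerivWithinAt (fun t : ℝ => t - s) 1 (Set.Ioi s) s :=
    ((hasDerivAt_id s).sub_const s).hasDerivWithinAt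
  have hcomp := (hasGenerator_iff.1 (h.apply s)).scomp_of_eq s hshift
    (fun t ht => Set.mem_Ioi.2 (sub_pos.2 ht)) (sub_self s).symm
  simpa only [Function.comp_def, ← ρ.map_add, sub_add_cancel, one_smul] using hcomp

lemma hasGenerator_integral (ρ : AutFlow A) (a : A) (h : ℝ) :
    ρ.HasGenerator (∫ s in (0 : ℝ)..h, ρ.toFun s a) (ρ.toFun h a - a) := by
  have hint (x y : ℝ) : IntervalIntegrable (fun s => ρ.toFun s a) MeasureTheory.volume x y :=
    (ρ.continuous a).intervalIntegrable x y
  have hderiv (y : ℝ) : HasDerivAt (fun y => ∫ s in (0 : ℝ)..y, ρ.toFun s a) (ρ.toFun y a) y :=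
    (ρ.continuous a).integral_hasStrictDerivAt 0 y |>.hasDerivAt
  have apply_integral (t : ℝ) : ρ.toFun t (∫ s in (0 : ℝ)..h, ρ.toFun s a) =
      (∫ s in (0 : ℝ)..(h + t), ρ.toFun s a) - ∫ s in (0 : ℝ)..t, ρ.toFun s a := by
    calc ρ.toFun t (∫ s in (0 : ℝ)..h, ρ.toFun s a)
        = ∫ s in (0 : ℝ)..h, ρ.toFun t (ρ.toFun s a) :=
          ((starHomCLM (ρ.toFun t)).intervalIntegral_comp_comm (hint 0 h)).symm
      _ = ∫ s in (0 : ℝ)..h, ρ.toFun (s + t) a := by simp only [add_comm _ t, ρ.map_add]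
      _ = ∫ s in t..(h + t), ρ.toFun s a := by
          rw [intervalIntegral.integral_comp_add_right (fun s => ρ.toFun s a), zero_add]
      _ = _ := (intervalIntegral.integral_interval_sub_left (hint _ _) (hint _ _)).symm
  have hshift : HasDerivAt (fun t => ∫ s in (0 : ℝ)..(h + t), ρ.toFun s a) (ρ.toFun h a) 0 :=
    HasDerivAt.comp_const_add h 0 (by simpa only [add_zero] using hderiv h)
  have hzero := hderiv 0
  rw [ρ.map_zero] at hzero
  rw [hasGenerator_iff]
  simp only [apply_integral]
  exact (hshift.sub hzero).hasDerivWithinAt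

lemma dense_domain (ρ : AutFlow A) : Dense (ρ.generator.domain : Set A) := by
  intro a
  have hlim := hasDerivAt_iff_tendsto_slope_zero.1
    ((ρ.continuous a).integral_hasStrictDerivAt 0 0).hasDerivAt
  simp only [zero_add, intervalIntegral.integral_same, sub_zero, ρ.map_zero] at hlim
  refine mem_closure_of_tendsto hlim (Filter.Eventually.of_forall fun h => ?_)
  rw [← Complex.coe_smul]
  exact Submodule.smul_mem _ _ (hasGenerator_integral ρ a h).mem_domain

end AutFlow

open AutFlow

variable {ρ : AutFlow A} {ω : StrongDual ℂ A}

lemma AutFlow.HasGenerator.hasDerivWithinAt_apply {a b : A} (h : ρ.HasGenerator a b)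
    (ω : StrongDual ℂ A) (s : ℝ) :
    HasDerivWithinAt (fun t => ω (ρ.toFun t a)) (ω (ρ.toFun s b)) (Set.Ioi s) s :=
  (ω.restrictScalars ℝ).hasFDerivAt.comp_hasDerivWithinAt s (h.hasDerivWithinAt s)

lemma IsInvariant.apply_eq_zero (hω : IsInvariant ρ ω) {a b : A} (h : ρ.HasGenerator a b) :
    ω b = 0 := by
  have hderiv := h.hasDerivWithinAt_apply ω 0
  simp only [hω _ _] at hderiv
  exact (uniqueDiffWithinAt_Ioi 0).eq_deriv _ hderiv (hasDerivWithinAt_const 0 _ _)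

lemma isInvariant_iff :
    IsInvariant ρ ω ↔ ∀ a b : A, ρ.HasGenerator a b → ω b = 0 := by
  refine ⟨fun hω a b h => hω.apply_eq_zero h, fun h => ?_⟩
  have eq_on_domain {t : ℝ} (ht : 0 ≤ t) {a : A} (ha : a ∈ ρ.generator.domain) :
      ω (ρ.toFun t a) = ω a := by
    have hgen := hasGenerator_generator ha
    have := constant_of_has_deriv_right_zero (a := 0) (b := t)
      (ω.continuous.comp (ρ.continuous a)).continuousOn (fun s _ => by
        have := hgen.hasDerivWithinAt_apply ω s
        rwa [h _ _ (hgen.apply s), hasDerivWithinAt_Ioi_iff_Ici] at this) t ⟨ht, le_rfl⟩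
    simpa only [Function.comp_apply, ρ.map_zero] using this
  have eq_of_nonneg {t : ℝ} (ht : 0 ≤ t) (a : A) : ω (ρ.toFun t a) = ω a :=
    congrFun (Continuous.ext_on ρ.dense_domain
      (ω.continuous.comp (starHomCLM (ρ.toFun t)).continuous) ω.continuous
      fun a ha => eq_on_domain ht ha) a
  intro t a
  rcases le_total 0 t with ht | ht
  · exact eq_of_nonneg ht a
  · rw [← eq_of_nonneg (neg_nonneg.2 ht), ← ρ.map_add, neg_add_cancel, ρ.map_zero]

end Flow

/-! ### Positive functionals and pure states -/

section PositiveFunctionals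

variable {A B : Type*} [CStarAlgebra A] [CStarAlgebra B]

/-- Positivity of a bounded functional, the normalization of states being dropped. -/
def IsPositive (φ : StrongDual ℂ A) : Prop :=
  ∀ a : A, 0 ≤ φ (star a * a)

/-- The functional `F ∘ f`, for a ⋆-homomorphism `f`. -/
def comap (F : StrongDual ℂ B) (f : A →⋆ₐ[ℂ] B) : StrongDual ℂ A :=
  F.comp (starHomCLM f)

/-- The functional `φ ∘ Ad_x`, where `Ad_x(a) = x⋆ a x` for an arbitrary element `x`. -/
def compAd (φ : StrongDual ℂ A) (x : A) : StrongDual ℂ A :=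
  φ.comp (ContinuousLinearMap.mulLeftRight ℂ A (star x) x)

@[simp]
lemma comap_apply (F : StrongDual ℂ B) (f : A →⋆ₐ[ℂ] B) (a : A) : comap F f a = F (f a) :=
  rfl

@[simp]
lemma compAd_apply (φ : StrongDual ℂ A) (x a : A) : compAd φ x a = φ (star x * a * x) :=
  rfl

lemma compAd_one (φ : StrongDual ℂ A) : compAd φ 1 = φ := by
  ext a
  rw [compAd_apply, star_one, one_mul, mul_one]

lemma compAd_compAd (φ : StrongDual ℂ A) (x y : A) :
    compAd (compAd φ x) y = compAd φ (y * x) := by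
  ext a
  simp only [compAd_apply, star_mul, mul_assoc]

lemma isPositive_of_mem_stateSpace {ω : StrongDual ℂ A} (hω : ω ∈ stateSpace A) : IsPositive ω :=
  hω.1

namespace IsPositive

variable {φ ψ : StrongDual ℂ A}

lemma add (hφ : IsPositive φ) (hψ : IsPositive ψ) : IsPositive (φ + ψ) := fun a =>
  add_nonneg (hφ a) (hψ a)

lemma real_smul (hφ : IsPositive φ) {r : ℝ} (hr : 0 ≤ r) : IsPositive (r • φ) := fun a =>
  smul_nonneg hr (hφ a)

lemma comap {F : StrongDual ℂ B} (hF : IsPositive F) (f : A →⋆ₐ[ℂ] B) :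
    IsPositive (comap F f) := fun a => by
  simpa only [comap_apply, map_mul, map_star] using hF (f a)

lemma compAd (hφ : IsPositive φ) (x : A) : IsPositive (compAd φ x) := fun a => by
  simpa only [compAd_apply, star_mul, mul_assoc] using hφ (a * x)

lemma exists_apply_one_eq (hφ : IsPositive φ) : ∃ r : ℝ, 0 ≤ r ∧ φ 1 = r := by
  have h := hφ 1
  rw [star_one, one_mul] at h
  exact ⟨(φ 1).re, (Complex.le_def.1 h).1, Complex.eq_re_of_ofReal_le (r := 0) (by simpa using h)⟩

lemma inv_smul_mem_stateSpace (hφ : IsPositive φ) {r : ℝ} (hr : 0 < r) (h : φ 1 = r) :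
    r⁻¹ • φ ∈ stateSpace A :=
  ⟨hφ.real_smul (inv_nonneg.2 hr.le), by
    rw [smul_apply, h, inv_smul_eq_iff₀ hr.ne', Complex.real_smul, mul_one]⟩

section Order

attribute [local instance 10] CStarAlgebra.spectralOrder CStarAlgebra.spectralOrderedRing

lemma apply_nonneg (hφ : IsPositive φ) {a : A} (ha : 0 ≤ a) : 0 ≤ φ a := by
  obtain ⟨y, rfl⟩ := CStarAlgebra.nonneg_iff_eq_star_mul_self.mp ha
  exact hφ y

lemma apply_mono (hφ : IsPositive φ) {a b : A} (h : a ≤ b) : φ a ≤ φ b := by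
  have := hφ.apply_nonneg (sub_nonneg.2 h)
  rwa [map_sub, sub_nonneg] at this

end Order

end IsPositive

lemma compAd_mem_stateSpace {ω : StrongDual ℂ A} (hω : ω ∈ stateSpace A) {u : A}
    (hu : u ∈ unitary A) : compAd ω u ∈ stateSpace A :=
  ⟨(isPositive_of_mem_stateSpace hω).compAd u, by
    rw [compAd_apply, mul_one, Unitary.star_mul_self_of_mem hu, hω.2]⟩

/-- Adding `ω` to both `φ` and `M • ω - φ` makes them nonzero, so that after normalization `ω` is a
proper convex combination of the two. -/
lemma eq_smul_of_isPositive_sub {ω φ : StrongDual ℂ A} (hω : ω ∈ pureStates A) (hφ : IsPositive φ)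
    {M : ℝ} (hM : IsPositive (M • ω - φ)) : φ = φ 1 • ω := by
  have hω_pos := isPositive_of_mem_stateSpace hω.1
  have hω_one : ω 1 = 1 := hω.1.2
  obtain ⟨c, hc0, hc⟩ := hφ.exists_apply_one_eq
  obtain ⟨d, hd0, hd⟩ := hM.exists_apply_one_eq
  have hφ_state : (c + 1)⁻¹ • (φ + ω) ∈ stateSpace A :=
    (hφ.add hω_pos).inv_smul_mem_stateSpace (by positivity) (by
      rw [add_apply, hc, hω_one]; norm_cast)
  have hψ_state : (d + 1)⁻¹ • ((M • ω - φ) + ω) ∈ stateSpace A :=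
    (hM.add hω_pos).inv_smul_mem_stateSpace (by positivity) (by
      rw [add_apply, hd, hω_one]; norm_cast)
  have hMcd : M = c + d := by
    rw [sub_apply, smul_apply, hc, hω_one, Complex.real_smul, mul_one] at hd
    exact_mod_cast (sub_eq_iff_eq_add'.1 hd)
  have hsegment : ω ∈ openSegment ℝ ((c + 1)⁻¹ • (φ + ω)) ((d + 1)⁻¹ • ((M • ω - φ) + ω)) := by
    refine ⟨(c + 1) / (c + d + 2), (d + 1) / (c + d + 2), by positivity, by positivity,
      by field_simp; ring, ?_⟩
    have hsum : ((c + d + 2)⁻¹ : ℝ) • ((φ + ω) + ((M • ω - φ) + ω)) = ω := by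
      rw [inv_smul_eq_iff₀ (by positivity), hMcd]
      module
    rw [smul_smul, smul_smul, div_mul_eq_mul_div, div_mul_eq_mul_div,
      mul_inv_cancel₀ (by positivity), mul_inv_cancel₀ (by positivity), one_div]
    exact (smul_add _ _ _).symm.trans hsum
  have hφω := hω.2 hφ_state hψ_state hsegment
  rw [inv_smul_eq_iff₀ (by positivity)] at hφω
  ext a
  have hφω_apply : φ a + ω a = ((c + 1 : ℝ) : ℂ) * ω a := congrArg (· a) hφω
  rw [smul_apply, hc, smul_eq_mul]
  push_cast at hφω_apply
  linear_combination hφω_apply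

lemma two_sub_le_norm_sub {φ ψ : StrongDual ℂ A} (hφ : φ 1 = 1) (hψ : ψ 1 = 1) {e : A}
    (he : ‖(2 : ℂ) • e - 1‖ ≤ 1) : 2 - 2 * (‖φ (1 - e)‖ + ‖ψ e‖) ≤ ‖φ - ψ‖ := by
  have happly : (φ - ψ) ((2 : ℂ) • e - 1) = 2 - 2 * (φ (1 - e) + ψ e) := by
    simp only [sub_apply, map_sub, map_smul, smul_eq_mul, hφ, hψ]
    ring
  calc 2 - 2 * (‖φ (1 - e)‖ + ‖ψ e‖)
      ≤ 2 - 2 * ‖φ (1 - e) + ψ e‖ := by gcongr; exact norm_add_le _ _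
    _ = ‖(2 : ℂ)‖ - ‖2 * (φ (1 - e) + ψ e)‖ := by rw [norm_mul, Complex.norm_two]
    _ ≤ ‖(2 : ℂ) - 2 * (φ (1 - e) + ψ e)‖ := norm_sub_norm_le _ _
    _ ≤ ‖φ - ψ‖ * ‖(2 : ℂ) • e - 1‖ := by rw [← happly]; exact (φ - ψ).le_opNorm _
    _ ≤ ‖φ - ψ‖ := mul_le_of_le_one_right (norm_nonneg _) he

end PositiveFunctionals

section Gns

attribute [local instance 10] CStarAlgebra.spectralOrder CStarAlgebra.spectralOrderedRing

variable {A : Type*} [CStarAlgebra A] (φ : stateSpace A)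

lemma gnsRep_gnsVector (a : A) :
    gnsRep φ a (gnsVector φ) =
      (((stateMap φ).toPreGNS a : (stateMap φ).PreGNS) : (stateMap φ).GNS) := by
  refine ((stateMap φ).gnsNonUnitalStarAlgHom_apply_coe (a := a)
    (b := (stateMap φ).toPreGNS 1)).trans ?_
  rw [PositiveLinearMap.leftMulMapPreGNS_apply, PositiveLinearMap.ofPreGNS_toPreGNS, mul_one]

lemma inner_gnsRep (a b : A) :
    ⟪gnsRep φ a (gnsVector φ), gnsRep φ b (gnsVector φ)⟫_ℂ = φ.1 (star a * b) := by
  rw [gnsRep_gnsVector, gnsRep_gnsVector]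
  exact UniformSpace.Completion.inner_coe _ _

lemma inner_gnsVector_gnsRep (a : A) : ⟪gnsVector φ, gnsRep φ a (gnsVector φ)⟫_ℂ = φ.1 a := by
  simpa using inner_gnsRep φ 1 a

lemma denseRange_gnsRep : DenseRange fun a : A => gnsRep φ a (gnsVector φ) := by
  simp only [gnsRep_gnsVector]
  exact (UniformSpace.Completion.denseRange_coe (α := (stateMap φ).PreGNS)).comp
    (stateMap φ).toPreGNS.surjective.denseRange (UniformSpace.Completion.continuous_coe _)

end Gns

/-! ### Irreducible representations -/

section Irreducible

variable {A : Type*} [CStarAlgebra A] {H : Type*} [NormedAddCommGroup H] [InnerProductSpace ℂ H]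
  [CompleteSpace H] {X : Type*} [Semiring X] [Algebra ℂ X] [InvolutiveStar X]
  {π : A →⋆ₐ[ℂ] (H →L[ℂ] H)} {Ω : H}

/-- The map `a ↦ π(a) y` of the algebra onto the orbit of a vector. -/
def orbitMap (π : A →⋆ₐ[ℂ] (H →L[ℂ] H)) (y : H) : A →L[ℂ] H :=
  (ContinuousLinearMap.apply ℂ H y).comp (starHomCLM π)

/-- The functional `a ↦ ⟪x, π(a) y⟫` attached to two vectors of a representation. -/
def matrixCoeff (π : A →⋆ₐ[ℂ] (H →L[ℂ] H)) (x y : H) : StrongDual ℂ A :=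
  (innerSL ℂ x).comp (orbitMap π y)

@[simp]
lemma matrixCoeff_apply (π : A →⋆ₐ[ℂ] (H →L[ℂ] H)) (x y : H) (a : A) :
    matrixCoeff π x y a = ⟪x, π a y⟫_ℂ :=
  rfl

/-- Triviality of the commutant; by Schur's lemma this is the absence of closed invariant
subspaces. -/
def IsIrreducible (π : A →⋆ₐ[ℂ] (H →L[ℂ] H)) : Prop :=
  ∀ T : H →L[ℂ] H, (∀ a, Commute T (π a)) → ∃ c : ℂ, T = c • 1

lemma map_mul_apply (π : X →⋆ₐ[ℂ] (H →L[ℂ] H)) (a b : X) (x : H) : π (a * b) x = π a (π b x) := by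
  rw [map_mul]; rfl

lemma norm_map_apply_le (π : A →⋆ₐ[ℂ] (H →L[ℂ] H)) (a : A) (x : H) : ‖π a x‖ ≤ ‖a‖ * ‖x‖ :=
  (π a).le_of_opNorm_le (NonUnitalStarAlgHom.norm_apply_le π a) x

lemma inner_map_star_left (π : X →⋆ₐ[ℂ] (H →L[ℂ] H)) (a : X) (x y : H) :
    ⟪π (star a) x, y⟫_ℂ = ⟪x, π a y⟫_ℂ := by
  rw [map_star, ContinuousLinearMap.star_eq_adjoint, ContinuousLinearMap.adjoint_inner_left]

lemma inner_map_left (π : X →⋆ₐ[ℂ] (H →L[ℂ] H)) (a : X) (x y : H) :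
    ⟪π a x, y⟫_ℂ = ⟪x, π (star a) y⟫_ℂ := by
  rw [← inner_map_star_left, star_star]

lemma apply_map_apply {T : H →L[ℂ] H} {a : A} (h : Commute T (π a)) (x : H) :
    T (π a x) = π a (T x) :=
  DFunLike.congr_fun h.eq x

lemma isPositive_matrixCoeff_apply {T : H →L[ℂ] H} (hT : 0 ≤ T) (h : ∀ a, Commute T (π a)) (Ω : H) :
    IsPositive (matrixCoeff π Ω (T Ω)) := fun a => by
  rw [matrixCoeff_apply, map_mul_apply, ← inner_map_left, ← apply_map_apply (h a)]
  exact (ContinuousLinearMap.nonneg_iff_isPositive T).1 hT |>.inner_nonneg_right _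

/-- The functional `a ↦ ⟪Ω, π(a) T Ω⟫` is dominated by `‖T‖` times the pure state, hence a multiple
of it. -/
lemma exists_eq_smul_one_of_nonneg (hΩ : DenseRange fun a => π a Ω)
    (hω : matrixCoeff π Ω Ω ∈ pureStates A) {T : H →L[ℂ] H} (hT : 0 ≤ T)
    (h : ∀ a, Commute T (π a)) : ∃ c : ℂ, T = c • 1 := by
  have hsub : 0 ≤ algebraMap ℝ (H →L[ℂ] H) ‖T‖ - T :=
    sub_nonneg.2 (IsSelfAdjoint.le_algebraMap_norm_self (.of_nonneg hT))
  have hdom : IsPositive (‖T‖ • matrixCoeff π Ω Ω - matrixCoeff π Ω (T Ω)) := by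
    convert isPositive_matrixCoeff_apply hsub
      (fun a => (Algebra.commute_algebraMap_left ‖T‖ (π a)).sub_left (h a)) Ω using 1
    ext a
    simp [Algebra.algebraMap_eq_smul_one, ← Complex.coe_smul]
  have hcoeff := eq_smul_of_isPositive_sub hω (isPositive_matrixCoeff_apply hT h Ω) hdom
  set c := matrixCoeff π Ω (T Ω) 1
  have inner_eq (a : A) : ⟪Ω, π a (T Ω)⟫_ℂ = ⟪Ω, π a (c • Ω)⟫_ℂ := by
    rw [map_smul, inner_smul_right]
    exact DFunLike.congr_fun hcoeff a
  have hTΩ : T Ω = c • Ω := hΩ.eq_of_inner_right ℂ fun a => by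
    rw [inner_map_left, inner_eq, ← inner_map_left]
  refine ⟨c, ContinuousLinearMap.ext fun x => ?_⟩
  refine congrFun (hΩ.equalizer T.continuous (c • (1 : H →L[ℂ] H)).continuous
    (funext fun a => ?_)) x
  simp [apply_map_apply (h a), hTΩ]

theorem isIrreducible_of_mem_pureStates (hΩ : DenseRange fun a => π a Ω)
    (hω : matrixCoeff π Ω Ω ∈ pureStates A) : IsIrreducible π := by
  have of_isSelfAdjoint {T : H →L[ℂ] H} (hT : IsSelfAdjoint T) (h : ∀ a, Commute T (π a)) :
      ∃ c : ℂ, T = c • 1 := by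
    have hnonneg : 0 ≤ T + algebraMap ℝ (H →L[ℂ] H) ‖T‖ :=
      neg_le_iff_add_nonneg.1 hT.neg_algebraMap_norm_le_self
    obtain ⟨c, hc⟩ := exists_eq_smul_one_of_nonneg hΩ hω hnonneg
      fun a => (h a).add_left (Algebra.commute_algebraMap_left ‖T‖ (π a))
    refine ⟨c - (‖T‖ : ℂ), ?_⟩
    rw [sub_smul, ← hc, Complex.coe_smul, Algebra.algebraMap_eq_smul_one, add_sub_cancel_right]
  intro T h
  have hstar (a : A) : Commute (star T) (π a) := by
    simpa only [map_star, star_star] using (h (star a)).star_star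
  obtain ⟨c, hc⟩ := of_isSelfAdjoint (realPart T).2 fun a => by
    rw [realPart_apply_coe]
    exact ((h a).add_left (hstar a)).smul_left _
  obtain ⟨d, hd⟩ := of_isSelfAdjoint (imaginaryPart T).2 fun a => by
    rw [imaginaryPart_apply_coe]
    exact (((h a).sub_left (hstar a)).smul_left _).smul_left _
  refine ⟨c + Complex.I * d, ?_⟩
  rw [← realPart_add_I_smul_imaginaryPart T, hc, hd]
  module

namespace IsIrreducible

variable (hπ : IsIrreducible π)
include hπ

lemma denseRange_apply {y : H} (hy : y ≠ 0) : DenseRange fun a => π a y := by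
  let orbit : Submodule ℂ H := (orbitMap π y).range
  let K : Submodule ℂ H := orbit.topologicalClosure
  have : CompleteSpace K := orbit.isClosed_topologicalClosure.completeSpace_coe
  have mapsTo (a : A) : ∀ v ∈ K, π a v ∈ K := by
    have : Set.MapsTo (π a) orbit orbit := by
      rintro _ ⟨b, rfl⟩
      exact ⟨a * b, map_mul_apply π a b y⟩
    exact this.closure (π a).continuous
  have mapsTo_orthogonal (a : A) : ∀ v ∈ Kᗮ, π a v ∈ Kᗮ := fun v hv k hk => by
    rw [← inner_map_star_left]
    exact hv _ (mapsTo _ k hk)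
  obtain ⟨c, hc⟩ := hπ K.starProjection fun a => ContinuousLinearMap.ext fun v =>
    Submodule.eq_starProjection_of_mem_orthogonal' (z := π a (v - K.starProjection v))
      (mapsTo a _ (K.starProjection_apply_mem v))
      (mapsTo_orthogonal a _ (K.sub_starProjection_mem_orthogonal v))
      ((congrArg (π a) (add_sub_cancel _ _).symm).trans (map_add _ _ _))
  have hyK : y ∈ K := Submodule.le_topologicalClosure _ ⟨1, by simp [orbitMap, starHomCLM]⟩
  have hcy : c • y = (1 : ℂ) • y := by
    simpa [hc] using Submodule.starProjection_eq_self_iff.2 hyK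
  have hc1 : c = 1 := smul_left_injective ℂ hy hcy
  intro v
  have hv : v ∈ K := Submodule.starProjection_eq_self_iff.1 (by simp [hc, hc1])
  exact hv

lemma exists_eq_smul_of_norm_le {x y : H} (h : ∀ a, ‖π a x‖ ≤ ‖π a y‖) : ∃ c : ℂ, x = c • y := by
  rcases eq_or_ne y 0 with rfl | hy
  · exact ⟨0, by simpa using h 1⟩
  let T : H →L[ℂ] H := (orbitMap π x).toLinearMap.extendOfNorm (orbitMap π y).toLinearMap
  have hT (a : A) : T (π a y) = π a x :=
    LinearMap.extendOfNorm_eq (hπ.denseRange_apply hy)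
      ⟨1, fun b => (h b).trans_eq (one_mul _).symm⟩ a
  obtain ⟨c, hc⟩ := hπ T fun a => ContinuousLinearMap.ext fun v =>
    congrFun ((hπ.denseRange_apply hy).equalizer (T * π a).continuous (π a * T).continuous
      (funext fun b => by
        change T (π a (π b y)) = π a (T (π b y))
        rw [← map_mul_apply, hT, hT, map_mul_apply])) v
  exact ⟨c, by simpa [hc] using (hT 1).symm⟩

/-- The symmetry removes the cross terms from `‖π(a) (y + i x)‖²`. -/
lemma exists_eq_smul_of_inner_eq {x y : H} (hy : y ≠ 0)
    (h : ∀ a, ⟪x, π a y⟫_ℂ = ⟪y, π a x⟫_ℂ) : ∃ c : ℂ, x = c • y := by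
  have inner_eq (a : A) : ⟪π a x, π a y⟫_ℂ = ⟪π a y, π a x⟫_ℂ := by
    simpa only [inner_map_left, ← map_mul_apply] using h (star a * a)
  have norm_le (a : A) : ‖π a x‖ ≤ ‖π a (y + Complex.I • x)‖ := by
    have hcross : RCLike.re ⟪π a y, Complex.I • π a x⟫_ℂ = 0 := by
      have him : (⟪π a y, π a x⟫_ℂ).im = 0 := by
        rw [← Complex.conj_eq_iff_im, inner_conj_symm, inner_eq]
      simpa [inner_smul_right] using him
    have hsq := norm_add_sq (𝕜 := ℂ) (π a y) (Complex.I • π a x)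
    rw [hcross, norm_smul, Complex.norm_I, one_mul, mul_zero, add_zero] at hsq
    rw [map_add, map_smul]
    exact (sq_le_sq₀ (norm_nonneg _) (norm_nonneg _)).1 (hsq ▸ le_add_of_nonneg_left (sq_nonneg _))
  obtain ⟨c, hc⟩ := hπ.exists_eq_smul_of_norm_le norm_le
  have hsmul : (1 - c * Complex.I) • x = c • y := by
    rw [smul_add, smul_smul] at hc
    rw [sub_smul, one_smul, sub_eq_iff_eq_add]
    exact hc
  have hne : 1 - c * Complex.I ≠ 0 := fun h0 => by
    rw [h0, zero_smul, eq_comm, smul_eq_zero] at hsmul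
    rw [hsmul.resolve_right hy] at h0
    simp at h0
  exact ⟨(1 - c * Complex.I)⁻¹ * c, by rw [mul_smul, ← hsmul, inv_smul_smul₀ hne]⟩

lemma exists_eq_smul_of_inner_apply_eq {x y z : H} (hy : y ≠ 0)
    (h : ∀ a, ⟪x, π a y⟫_ℂ = ⟪y, π a z⟫_ℂ) : ∃ c : ℂ, x = c • y := by
  have h' (a : A) : ⟪z, π a y⟫_ℂ = ⟪y, π a x⟫_ℂ := by
    rw [← inner_map_star_left, ← inner_conj_symm, ← h, inner_conj_symm, inner_map_star_left]
  obtain ⟨c, hc⟩ := hπ.exists_eq_smul_of_inner_eq hy (x := x + z) fun a => by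
    rw [inner_add_left, map_add, inner_add_right, h, h', add_comm]
  obtain ⟨d, hd⟩ := hπ.exists_eq_smul_of_inner_eq hy (x := Complex.I • (x - z)) fun a => by
    rw [inner_smul_left, map_smul, inner_smul_right, inner_sub_left, map_sub, inner_sub_right, h,
      h', Complex.conj_I]
    ring
  refine ⟨(c - Complex.I * d) / 2, ?_⟩
  calc x = (1 / 2 : ℂ) • ((x + z) - Complex.I • Complex.I • (x - z)) := by
        rw [smul_smul, Complex.I_mul_I]; module
    _ = _ := by rw [hc, hd]; module

end IsIrreducible

end Irreducible

/-! ### Pure states related by a unitary -/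

section UnitaryEquivalence

variable {A : Type*} [CStarAlgebra A]

section Gns

lemma matrixCoeff_gnsRep (φ : stateSpace A) :
    matrixCoeff (gnsRep φ) (gnsVector φ) (gnsVector φ) = φ :=
  ContinuousLinearMap.ext (inner_gnsVector_gnsRep φ)

lemma isIrreducible_gnsRep {φ : stateSpace A} (hφ : φ.1 ∈ pureStates A) :
    IsIrreducible (gnsRep φ) :=
  isIrreducible_of_mem_pureStates (denseRange_gnsRep φ) (by rwa [matrixCoeff_gnsRep])

lemma gnsVector_ne_zero (φ : stateSpace A) : gnsVector φ ≠ 0 :=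
  norm_ne_zero_iff.1 (by rw [norm_gnsVector]; exact one_ne_zero)

lemma norm_gnsRep_sq (φ : stateSpace A) (a : A) :
    ‖gnsRep φ a (gnsVector φ)‖ ^ 2 = ‖φ.1 (star a * a)‖ := by
  rw [← inner_gnsRep, inner_self_eq_norm_sq_to_K]
  simp

lemma norm_compAd_mul_star_self (φ : stateSpace A) (u a : A) :
    ‖compAd φ.1 u (a * star a)‖ = ‖gnsRep φ (star a) (gnsRep φ u (gnsVector φ))‖ ^ 2 := by
  rw [← map_mul_apply, norm_gnsRep_sq, star_mul, star_star, compAd_apply]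
  simp only [mul_assoc]

lemma norm_apply_le_norm_gnsRep (φ : stateSpace A) (a : A) :
    ‖φ.1 a‖ ≤ ‖gnsRep φ a (gnsVector φ)‖ := by
  rw [← inner_gnsVector_gnsRep]
  simpa only [norm_gnsVector, one_mul] using
    norm_inner_le_norm (𝕜 := ℂ) (gnsVector φ) (gnsRep φ a (gnsVector φ))

end Gns

/-- In the GNS representation of `ω`, the vector of `w` is a multiple of that of `1`. -/
lemma apply_mul_of_compAd_eq {ω : StrongDual ℂ A} (hω : ω ∈ pureStates A) {w : A}
    (hw : compAd ω w = ω) (a : A) : ω (a * w) = ω w * ω a := by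
  let φ : stateSpace A := ⟨ω, hω.1⟩
  obtain ⟨c, hc⟩ := (isIrreducible_gnsRep (φ := φ) hω).exists_eq_smul_of_norm_le
    (x := gnsRep φ w (gnsVector φ)) (y := gnsVector φ) fun a => by
      rw [← sq_le_sq₀ (norm_nonneg _) (norm_nonneg _), ← map_mul_apply, norm_gnsRep_sq,
        norm_gnsRep_sq, star_mul, mul_assoc, ← mul_assoc (star a), ← mul_assoc]
      exact (congrArg norm (DFunLike.congr_fun hw (star a * a))).le
  have apply_mul (b : A) : ω (b * w) = c * ω b := by
    calc ω (b * w) = ⟪gnsVector φ, gnsRep φ b (gnsRep φ w (gnsVector φ))⟫_ℂ := by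
          rw [← map_mul_apply, inner_gnsVector_gnsRep]
      _ = c * ω b := by
          rw [hc, map_smul, inner_smul_right, inner_gnsVector_gnsRep]
  have hcw : ω w = c := by simpa [show ω 1 = 1 from hω.1.2] using apply_mul 1
  rw [hcw, apply_mul]

section Approximation

attribute [local instance 10] CStarAlgebra.spectralOrder CStarAlgebra.spectralOrderedRing

lemma norm_cfc_mul_le {a : A} {f : ℝ → ℝ} {δ : ℝ} (hδ : 0 ≤ δ) (hf : Continuous f)
    (h : ∀ t ∈ spectrum ℝ (a * star a), ‖f t * t * f t‖ ≤ δ ^ 2) :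
    ‖cfc f (a * star a) * a‖ ≤ δ := by
  have mul_star_eq : cfc f (a * star a) * a * star (cfc f (a * star a) * a) =
      cfc (fun t => f t * t * f t) (a * star a) := by
    rw [cfc_mul _ _ (a * star a), cfc_mul _ _ (a * star a), cfc_id' ℝ (a * star a), star_mul,
      (cfc_predicate f (a * star a) : IsSelfAdjoint _).star_eq]
    simp only [mul_assoc]
  refine (sq_le_sq₀ (norm_nonneg _) hδ).1 ?_
  rw [sq, ← CStarRing.norm_self_mul_star, mul_star_eq]
  exact norm_cfc_le (by positivity) h

/-- A bounded version of the range projection of `a`: the witness is the continuous functional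
calculus of `a a⋆` for a function which agrees with the indicator of `(0, ∞)` above `δ²`. -/
lemma exists_approx_rangeProjection (a : A) {δ : ℝ} (hδ : 0 < δ) :
    ∃ e : A, 0 ≤ e ∧ e ≤ (δ ^ 2)⁻¹ • (a * star a) ∧ ‖(1 - e) * a‖ ≤ δ ∧ ‖1 - e‖ ≤ 1 ∧
      ‖(2 : ℂ) • e - 1‖ ≤ 1 := by
  set h := a * star a
  have hh : 0 ≤ h := mul_star_self_nonneg a
  have spectrum_nonneg {t : ℝ} (ht : t ∈ spectrum ℝ h) : 0 ≤ t := spectrum_nonneg_of_nonneg hh ht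
  let f : ℝ → ℝ := fun t => min 1 ((δ ^ 2)⁻¹ * t)
  have f_nonneg {t : ℝ} (ht : 0 ≤ t) : 0 ≤ f t := le_min zero_le_one (by positivity)
  have f_le_one (t : ℝ) : f t ≤ 1 := min_le_left _ _
  have one_sub_eq : 1 - cfc f h = cfc (fun t => 1 - f t) h := by
    rw [cfc_sub _ _ h, cfc_const_one ℝ h]
  refine ⟨cfc f h, cfc_nonneg fun t ht => f_nonneg (spectrum_nonneg ht), ?_, ?_, ?_, ?_⟩
  · calc cfc f h ≤ cfc (fun t => (δ ^ 2)⁻¹ * t) h := cfc_mono fun t _ => min_le_right _ _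
      _ = (δ ^ 2)⁻¹ • h := cfc_const_mul_id _ h
  · rw [one_sub_eq]
    refine norm_cfc_mul_le hδ.le (by fun_prop) fun t ht => ?_
    have ht0 := spectrum_nonneg ht
    have h0 : 0 ≤ 1 - f t := sub_nonneg.2 (f_le_one t)
    have h1 : 1 - f t ≤ 1 := sub_le_self _ (f_nonneg ht0)
    rw [Real.norm_of_nonneg (by positivity)]
    rcases le_total t (δ ^ 2) with hle | hge
    · calc (1 - f t) * t * (1 - f t) ≤ 1 * t * 1 := by gcongr
        _ ≤ δ ^ 2 := by simpa using hle
    · have : f t = 1 := min_eq_left (by rwa [← div_eq_inv_mul, one_le_div (by positivity)])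
      simp [this, sq_nonneg]
  · rw [one_sub_eq]
    refine norm_cfc_le zero_le_one fun t ht => ?_
    rw [Real.norm_of_nonneg (sub_nonneg.2 (f_le_one t))]
    exact sub_le_self _ (f_nonneg (spectrum_nonneg ht))
  · have : (2 : ℂ) • cfc f h - 1 = cfc (fun t => 2 * f t - 1) h := by
      rw [cfc_sub _ _ h, cfc_const_mul _ _ h, cfc_const_one ℝ h, ← Complex.coe_smul]
      norm_num
    rw [this]
    refine norm_cfc_le zero_le_one fun t ht => ?_
    rw [Real.norm_eq_abs, abs_le]
    constructor <;> linarith [f_nonneg (spectrum_nonneg ht), f_le_one t]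

end Approximation

lemma exists_norm_sub_lt_of_inner {X F : Type*} [AddCommGroup X] [Module ℝ X]
    [NormedAddCommGroup F] [InnerProductSpace ℝ F] [CompleteSpace F] (f g : X →ₗ[ℝ] F) (x y : F)
    (h : ∀ η ζ : F, (∀ a, ⟪η, f a⟫_ℝ + ⟪ζ, g a⟫_ℝ = 0) → ⟪η, x⟫_ℝ + ⟪ζ, y⟫_ℝ = 0)
    {ε : ℝ} (hε : 0 < ε) : ∃ a, ‖f a - x‖ < ε ∧ ‖g a - y‖ < ε := by
  let k : X →ₗ[ℝ] WithLp 2 (F × F) :=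
    (WithLp.linearEquiv 2 ℝ (F × F)).symm.toLinearMap ∘ₗ f.prod g
  have hmem : WithLp.toLp 2 (x, y) ∈ k.range.topologicalClosure := by
    rw [← Submodule.orthogonal_orthogonal_eq_closure]
    intro z hz
    rw [WithLp.prod_inner_apply]
    refine h _ _ fun a => ?_
    have := hz _ ⟨a, rfl⟩
    rwa [real_inner_comm, WithLp.prod_inner_apply] at this
  obtain ⟨_, ⟨a, rfl⟩, hdist⟩ := Metric.mem_closure_iff.1 hmem ε hε
  rw [dist_eq_norm, norm_sub_rev] at hdist
  exact ⟨a, (WithLp.norm_fst_le F (k a - WithLp.toLp 2 (x, y))).trans_lt hdist,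
    (WithLp.norm_snd_le F (k a - WithLp.toLp 2 (x, y))).trans_lt hdist⟩

section Representation

variable {H : Type*} [NormedAddCommGroup H] [InnerProductSpace ℂ H] [CompleteSpace H]
  {π : A →⋆ₐ[ℂ] (H →L[ℂ] H)} {Ω : H} {u : A}

lemma IsIrreducible.inner_eq_zero (hπ : IsIrreducible π) (hΩ : Ω ≠ 0) (hu : u ∈ unitary A)
    (horth : ⟪Ω, π u Ω⟫_ℂ = 0) {η ζ : H}
    (h : ∀ a, (⟪η, π a Ω⟫_ℂ + ⟪π u Ω, π a ζ⟫_ℂ).re = 0) : ⟪η, Ω⟫_ℂ = 0 := by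
  have hzero (a : A) : ⟪η, π a Ω⟫_ℂ + ⟪π u Ω, π a ζ⟫_ℂ = 0 := by
    refine Complex.ext (h a) ?_
    have him := h (Complex.I • a)
    simp only [map_smul, smul_apply, inner_smul_right, ← mul_add, Complex.I_mul_re] at him
    exact neg_eq_zero.1 him
  obtain ⟨c, hc⟩ := hπ.exists_eq_smul_of_inner_apply_eq (x := π (star u) η) (z := -ζ) hΩ fun a => by
    have hua := eq_neg_of_add_eq_zero_left (hzero (u * a))
    rw [map_mul_apply, map_mul_apply, inner_map_left π u, ← map_mul_apply π (star u) u,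
      Unitary.star_mul_self_of_mem hu, map_one] at hua
    rwa [inner_map_star_left, map_neg, inner_neg_right]
  have hη : η = c • π u Ω := by
    rw [← map_smul, ← hc, ← map_mul_apply, Unitary.mul_star_self_of_mem hu, map_one]
    rfl
  rw [hη, inner_smul_left, ← inner_conj_symm, horth, map_zero, mul_zero]

lemma IsIrreducible.exists_norm_lt (hπ : IsIrreducible π) (hΩ : Ω ≠ 0) (hu : u ∈ unitary A)
    (horth : ⟪Ω, π u Ω⟫_ℂ = 0) {ε : ℝ} (hε : 0 < ε) :
    ∃ a, ‖π a Ω - Ω‖ < ε ∧ ‖π (star a) (π u Ω)‖ < ε := by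
  let : InnerProductSpace ℝ H := InnerProductSpace.complexToReal
  let f : A →ₗ[ℝ] H := (orbitMap π Ω).toLinearMap.restrictScalars ℝ
  let g : A →ₗ[ℝ] H := ((orbitMap π (π u Ω)).toLinearMap.restrictScalars ℝ).comp
    (starL' ℝ : A ≃L[ℝ] A).toLinearMap
  obtain ⟨a, hf, hg⟩ := exists_norm_sub_lt_of_inner f g Ω 0 (fun η ζ h => by
    have hre (a : A) : (⟪η, π a Ω⟫_ℂ + ⟪π u Ω, π a ζ⟫_ℂ).re = 0 := by
      rw [Complex.add_re, ← inner_map_star_left π a _ ζ, ← inner_conj_symm _ ζ, Complex.conj_re]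
      exact h a
    rw [inner_zero_right, add_zero]
    exact congrArg Complex.re (hπ.inner_eq_zero hΩ hu horth hre)) hε
  exact ⟨a, hf, by rwa [sub_zero] at hg⟩

end Representation

section Order

attribute [local instance 10] CStarAlgebra.spectralOrder CStarAlgebra.spectralOrderedRing

variable {ω : StrongDual ℂ A} {u : A}

/-- By irreducibility some `a` almost fixes the GNS vector `Ω` while `π(a⋆)` almost annihilates
`π(u)Ω`; an approximate range projection `e` of `a` then has `ω(e) ≈ 1` and `ω(u⋆ e u) ≈ 0`. -/
lemma two_sub_le_norm_sub_compAd (hω : ω ∈ pureStates A) (hu : u ∈ unitary A)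
    (h0 : ω u = 0) {δ : ℝ} (hδ : 0 < δ) :
    2 - 2 * ((δ + δ ^ 2) + δ ^ 2) ≤ ‖ω - compAd ω u‖ := by
  let φ : stateSpace A := ⟨ω, hω.1⟩
  set π := gnsRep φ
  set Ω := gnsVector φ
  have horth : ⟪Ω, π u Ω⟫_ℂ = 0 := by rw [inner_gnsVector_gnsRep, h0]
  obtain ⟨a, hfix, hkill⟩ := (isIrreducible_gnsRep (φ := φ) hω).exists_norm_lt
    (gnsVector_ne_zero φ) hu horth (pow_pos hδ 2)
  obtain ⟨e, he_nonneg, he_le, hea, he_one, hnorm⟩ := exists_approx_rangeProjection a hδ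
  have hω₂ := compAd_mem_stateSpace hω.1 hu
  have hleft : ‖ω (1 - e)‖ ≤ δ + δ ^ 2 := by
    have hsplit : π (1 - e) Ω = π ((1 - e) * a) Ω - π (1 - e) (π a Ω - Ω) := by
      rw [map_sub (π (1 - e)), map_mul_apply, sub_sub_cancel]
    calc ‖ω (1 - e)‖ ≤ ‖π (1 - e) Ω‖ := norm_apply_le_norm_gnsRep φ _
      _ ≤ ‖(1 - e) * a‖ * ‖Ω‖ + ‖1 - e‖ * ‖π a Ω - Ω‖ := by
        rw [hsplit]
        exact (norm_sub_le _ _).trans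
          (add_le_add (norm_map_apply_le π _ _) (norm_map_apply_le π _ _))
      _ ≤ δ * 1 + 1 * δ ^ 2 := by
        rw [norm_gnsVector]
        gcongr
      _ = δ + δ ^ 2 := by ring
  have hright : ‖compAd ω u e‖ ≤ δ ^ 2 := by
    calc ‖compAd ω u e‖ ≤ ‖compAd ω u ((δ ^ 2)⁻¹ • (a * star a))‖ :=
          CStarAlgebra.norm_le_norm_of_nonneg_of_le
            ((isPositive_of_mem_stateSpace hω₂).apply_nonneg he_nonneg)
            ((isPositive_of_mem_stateSpace hω₂).apply_mono he_le)
      _ = (δ ^ 2)⁻¹ * ‖π (star a) (π u Ω)‖ ^ 2 := by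
          rw [← Complex.coe_smul, map_smul, norm_smul, norm_compAd_mul_star_self φ,
            Complex.norm_of_nonneg (by positivity)]
      _ ≤ (δ ^ 2)⁻¹ * (δ ^ 2) ^ 2 := by gcongr
      _ = δ ^ 2 := by field_simp
  calc 2 - 2 * ((δ + δ ^ 2) + δ ^ 2) ≤ 2 - 2 * (‖ω (1 - e)‖ + ‖compAd ω u e‖) := by gcongr
    _ ≤ ‖ω - compAd ω u‖ := two_sub_le_norm_sub hω.1.2 hω₂.2 hnorm

end Order

theorem two_le_norm_sub_compAd {ω : StrongDual ℂ A} (hω : ω ∈ pureStates A) {u : A}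
    (hu : u ∈ unitary A) (h0 : ω u = 0) : 2 ≤ ‖ω - compAd ω u‖ := by
  have hlim : Filter.Tendsto (fun δ : ℝ => 2 - 2 * ((δ + δ ^ 2) + δ ^ 2)) (𝓝[>] 0) (𝓝 2) :=
    tendsto_nhdsWithin_of_tendsto_nhds (Continuous.tendsto' (by fun_prop) _ _ (by norm_num))
  exact le_of_tendsto hlim (eventually_mem_nhdsWithin.mono fun δ hδ =>
    two_sub_le_norm_sub_compAd hω hu h0 hδ)

end UnitaryEquivalence

/-! ### The index -/

section Index

variable {A : Type*} [CStarAlgebra A] {ρ : AutFlow A} {ω ω₁ ω₂ ω₃ : StrongDual ℂ A}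
  {u v b c : A}

namespace Intertwines

lemma eq_compAd (hu : Intertwines ρ ω₁ ω₂ u) : ω₂ = compAd ω₁ u :=
  ContinuousLinearMap.ext hu.eq_comp

lemma refl : Intertwines ρ ω ω 1 :=
  ⟨one_mem _, AutFlow.hasGenerator_one.mem_domain, fun a => by simp⟩

lemma trans (hu : Intertwines ρ ω₁ ω₂ u) (hv : Intertwines ρ ω₂ ω₃ v) :
    Intertwines ρ ω₁ ω₃ (v * u) where
  unitary := mul_mem hv.unitary hu.unitary
  mem_domain := ((AutFlow.hasGenerator_generator hv.mem_domain).mul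
    (AutFlow.hasGenerator_generator hu.mem_domain)).mem_domain
  eq_comp a := by rw [hv.eq_compAd, hu.eq_compAd, compAd_compAd, compAd_apply]

lemma symm (hu : Intertwines ρ ω₁ ω₂ u) : Intertwines ρ ω₂ ω₁ (star u) where
  unitary := Unitary.star_mem hu.unitary
  mem_domain := (AutFlow.hasGenerator_generator hu.mem_domain).star.mem_domain
  eq_comp a := by
    rw [hu.eq_compAd, ← compAd_apply, compAd_compAd, Unitary.star_mul_self_of_mem hu.unitary,
      compAd_one]

end Intertwines

namespace Admissible

lemma exists_intertwines (h : Admissible ρ ω₁ ω₂) :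
    ∃ u b, Intertwines ρ ω₁ ω₂ u ∧ ρ.HasGenerator u b := by
  obtain ⟨u, hu⟩ := h.comparable.2.2
  exact ⟨u, _, hu, AutFlow.hasGenerator_generator hu.mem_domain⟩

lemma refl (hω : ω ∈ pureStates A) (hinv : IsInvariant ρ ω) : Admissible ρ ω ω :=
  ⟨⟨hω, hω, 1, .refl⟩, hinv, hinv⟩

lemma trans (h : Admissible ρ ω₁ ω₂) (h' : Admissible ρ ω₂ ω₃) : Admissible ρ ω₁ ω₃ := by
  obtain ⟨u, hu⟩ := h.comparable.2.2
  obtain ⟨v, hv⟩ := h'.comparable.2.2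
  exact ⟨⟨h.comparable.1, h'.comparable.2.1, _, hu.trans hv⟩, h.invariant_left, h'.invariant_right⟩

lemma symm (h : Admissible ρ ω₁ ω₂) : Admissible ρ ω₂ ω₁ := by
  obtain ⟨u, hu⟩ := h.comparable.2.2
  exact ⟨⟨h.comparable.2.1, h.comparable.1, _, hu.symm⟩, h.invariant_right, h.invariant_left⟩

end Admissible

lemma compAd_star_mul (hv : v ∈ unitary A) (h : compAd ω u = compAd ω v) :
    compAd ω (star v * u) = ω := by
  rw [← compAd_compAd, h, compAd_compAd, Unitary.star_mul_self_of_mem hv, compAd_one]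

lemma apply_star_mul_leibniz (ω : StrongDual ℂ A) (hv : v ∈ unitary A) (u b c : A) :
    ω (star (v * u) * (c * u + v * b)) = compAd ω u (star v * c) + ω (star u * b) := by
  rw [compAd_apply, ← map_add]
  congr 1
  calc star (v * u) * (c * u + v * b)
      = star u * (star v * c) * u + star u * ((star v * v) * b) := by
        rw [star_mul]; simp only [mul_add, mul_assoc]
    _ = _ := by rw [Unitary.star_mul_self_of_mem hv, one_mul]

lemma apply_star_mul_eq_zero (hω : ω ∈ pureStates A) (hinv : IsInvariant ρ ω)
    (hu : compAd ω u = ω) (hb : ρ.HasGenerator u b) : ω (star u * b) = 0 := by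
  have hsum : ω (star b * u) + ω (star u * b) = 0 := by
    rw [← map_add, hinv.apply_eq_zero (hb.star.mul hb)]
  rwa [apply_mul_of_compAd_eq hω hu, hinv.apply_eq_zero hb.star, mul_zero, zero_add] at hsum

/-- Write `u = v w` with `w = v⋆ u`: the unitary `w` fixes `ω`, so it does not contribute. -/
lemma apply_star_mul_eq (hω : ω ∈ pureStates A) (hinv : IsInvariant ρ ω) (hv : v ∈ unitary A)
    (h : compAd ω u = compAd ω v) (hb : ρ.HasGenerator u b) (hc : ρ.HasGenerator v c) :
    ω (star u * b) = ω (star v * c) := by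
  have hw := compAd_star_mul hv h
  have hvw : v * (star v * u) = u := by rw [← mul_assoc, Unitary.mul_star_self_of_mem hv, one_mul]
  obtain ⟨d, hd⟩ : ∃ d, ρ.HasGenerator (star v * u) d := ⟨_, hc.star.mul hb⟩
  have hvd := hc.mul hd
  have hleibniz := apply_star_mul_leibniz ω hv (star v * u) d c
  rw [hvw] at hvd hleibniz
  rw [tendsto_nhds_unique hb hvd, hleibniz, hw, apply_star_mul_eq_zero hω hinv hw hd, add_zero]

lemma index_eq (h : Admissible ρ ω₁ ω₂) (hu : Intertwines ρ ω₁ ω₂ u) (hb : ρ.HasGenerator u b) :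
    index ρ ω₁ ω₂ = Complex.I * ω₁ (star u * b) := by
  have hex : ∃ u : A, Intertwines ρ ω₁ ω₂ u := ⟨u, hu⟩
  rw [index, dif_pos hex, indexValue]
  congr 1
  exact apply_star_mul_eq h.comparable.1 h.invariant_left hu.unitary
    (hex.choose_spec.eq_compAd.symm.trans hu.eq_compAd) (AutFlow.hasGenerator_generator _) hb

lemma index_self (hω : ω ∈ pureStates A) (hinv : IsInvariant ρ ω) : index ρ ω ω = 0 := by
  rw [index_eq (.refl hω hinv) .refl AutFlow.hasGenerator_one, mul_zero, map_zero, mul_zero]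

lemma index_add (h : Admissible ρ ω₁ ω₂) (h' : Admissible ρ ω₂ ω₃) :
    index ρ ω₁ ω₂ + index ρ ω₂ ω₃ = index ρ ω₁ ω₃ := by
  obtain ⟨u, b, hu, hb⟩ := h.exists_intertwines
  obtain ⟨v, c, hv, hc⟩ := h'.exists_intertwines
  rw [index_eq h hu hb, index_eq h' hv hc, index_eq (h.trans h') (hu.trans hv) (hc.mul hb),
    apply_star_mul_leibniz ω₁ hv.unitary, ← hu.eq_compAd]
  ring

lemma index_symm (h : Admissible ρ ω₁ ω₂) : index ρ ω₁ ω₂ = -index ρ ω₂ ω₁ := by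
  rw [eq_neg_iff_add_eq_zero, index_add h h.symm, index_self h.comparable.1 h.invariant_left]

end Index

section Phase

lemma eq_exp_of_map_add {l : ℝ → ℂ} {κ : ℂ} (hcont : Continuous l) (hzero : l 0 = 1)
    (hadd : ∀ s t, l (s + t) = l s * l t) (hderiv : HasDerivWithinAt l κ (Set.Ioi 0) 0) {t : ℝ}
    (ht : 0 ≤ t) : l t = Complex.exp (t * κ) := by
  have hderiv_at (s : ℝ) : HasDerivWithinAt l (l s * κ) (Set.Ici s) s := by
    have hshift : HasDerivWithinAt (fun r : ℝ => r - s) 1 (Set.Ioi s) s :=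
      ((hasDerivAt_id s).sub_const s).hasDerivWithinAt
    have hcomp := hderiv.scomp_of_eq s hshift (fun r hr => Set.mem_Ioi.2 (sub_pos.2 hr))
      (sub_self s).symm
    rw [one_smul] at hcomp
    rw [← hasDerivWithinAt_Ioi_iff_Ici]
    simpa only [Function.comp_def, ← hadd, add_sub_cancel] using hcomp.const_mul (l s)
  have hexp (s : ℝ) :
      HasDerivAt (fun s : ℝ => Complex.exp (-(s * κ))) (Complex.exp (-(s * κ)) * -(1 * κ)) s :=
    (Complex.ofRealCLM.hasDerivAt.mul_const κ).neg.cexp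
  have hconst := constant_of_has_deriv_right_zero (a := 0) (b := t)
    (f := fun s : ℝ => l s * Complex.exp (-(s * κ))) (by fun_prop)
    (fun s _ => ((hderiv_at s).mul (hexp s).hasDerivWithinAt).congr_deriv (by ring)) t ⟨ht, le_rfl⟩
  rw [hzero, Complex.ofReal_zero, zero_mul, neg_zero, Complex.exp_zero, mul_one, Complex.exp_neg,
    mul_inv_eq_one₀ (Complex.exp_ne_zero _)] at hconst
  exact hconst

variable {A : Type*} [CStarAlgebra A] {ρ : AutFlow A} {ω₁ ω₂ : StrongDual ℂ A} {u b : A}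

/-- The cocycle `w_t = u⋆ ρ_t(u)` of a unitary, satisfying `w_{s+t} = w_s ρ_s(w_t)`. If `u`
intertwines two invariant states, then `w_t` fixes the first one, and a pure state evaluates it to a
phase. -/
def cocycle (ρ : AutFlow A) (u : A) (t : ℝ) : A :=
  star u * ρ.toFun t u

lemma cocycle_add (hu : u ∈ unitary A) (s t : ℝ) :
    cocycle ρ u (s + t) = cocycle ρ u s * ρ.toFun s (cocycle ρ u t) := by
  calc star u * ρ.toFun (s + t) u
      = star u * ρ.toFun s (u * star u) * ρ.toFun s (ρ.toFun t u) := by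
        rw [Unitary.mul_star_self_of_mem hu, map_one, mul_one, ρ.map_add]
    _ = _ := by simp only [cocycle, map_mul, mul_assoc]

lemma cocycle_zero (hu : u ∈ unitary A) : cocycle ρ u 0 = 1 := by
  rw [cocycle, ρ.map_zero, Unitary.star_mul_self_of_mem hu]

lemma Intertwines.compAd_apply_flow (hu : Intertwines ρ ω₁ ω₂ u) (h₁ : IsInvariant ρ ω₁)
    (h₂ : IsInvariant ρ ω₂) (t : ℝ) : compAd ω₁ (ρ.toFun t u) = compAd ω₁ u := by
  ext a
  calc compAd ω₁ (ρ.toFun t u) a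
      = ω₁ (ρ.toFun t (star u * ρ.toFun (-t) a * u)) := by
        rw [map_mul (ρ.toFun t), map_mul (ρ.toFun t), map_star, ρ.apply_neg_apply, compAd_apply]
    _ = compAd ω₁ u a := by rw [h₁, ← hu.eq_comp, h₂, hu.eq_compAd]

lemma apply_mul_cocycle (h : Admissible ρ ω₁ ω₂) (hu : Intertwines ρ ω₁ ω₂ u) (t : ℝ) (a : A) :
    ω₁ (a * cocycle ρ u t) = ω₁ (cocycle ρ u t) * ω₁ a :=
  apply_mul_of_compAd_eq h.comparable.1 (compAd_star_mul hu.unitary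
    (hu.compAd_apply_flow h.invariant_left h.invariant_right t)) a

lemma apply_cocycle_add (h : Admissible ρ ω₁ ω₂) (hu : Intertwines ρ ω₁ ω₂ u) (s t : ℝ) :
    ω₁ (cocycle ρ u (s + t)) = ω₁ (cocycle ρ u s) * ω₁ (cocycle ρ u t) := by
  have hflow : cocycle ρ u s * ρ.toFun s (cocycle ρ u t) =
      ρ.toFun s (ρ.toFun (-s) (cocycle ρ u s) * cocycle ρ u t) := by
    rw [map_mul, ρ.apply_neg_apply]
  rw [cocycle_add hu.unitary, hflow, h.invariant_left, apply_mul_cocycle h hu, h.invariant_left,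
    mul_comm]

lemma hasDerivWithinAt_apply_cocycle (ω : StrongDual ℂ A) (hb : ρ.HasGenerator u b) :
    HasDerivWithinAt (fun t => ω (cocycle ρ u t)) (ω (star u * b)) (Set.Ioi 0) 0 :=
  (ω.restrictScalars ℝ).hasFDerivAt.comp_hasDerivWithinAt 0
    ((AutFlow.hasGenerator_iff.1 hb).const_mul (star u))

lemma apply_cocycle_eq_exp (h : Admissible ρ ω₁ ω₂) (hu : Intertwines ρ ω₁ ω₂ u)
    (hb : ρ.HasGenerator u b) {t : ℝ} (ht : 0 ≤ t) :
    ω₁ (cocycle ρ u t) = Complex.exp (t * ω₁ (star u * b)) :=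
  eq_exp_of_map_add (l := fun t => ω₁ (cocycle ρ u t))
    (ω₁.continuous.comp (continuous_const.mul (ρ.continuous u)))
    (by rw [cocycle_zero hu.unitary, h.comparable.1.1.2]) (apply_cocycle_add h hu)
    (hasDerivWithinAt_apply_cocycle ω₁ hb) ht

theorem exists_index_eq_intCast (hρ : ∀ a, ρ.toFun (2 * Real.pi) a = a)
    (h : Admissible ρ ω₁ ω₂) : ∃ n : ℤ, index ρ ω₁ ω₂ = n := by
  obtain ⟨u, b, hu, hb⟩ := h.exists_intertwines
  have hexp := apply_cocycle_eq_exp h hu hb Real.two_pi_pos.le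
  rw [cocycle, hρ, Unitary.star_mul_self_of_mem hu.unitary, h.comparable.1.1.2, eq_comm,
    Complex.exp_eq_one_iff] at hexp
  obtain ⟨n, hn⟩ := hexp
  have hvalue : ω₁ (star u * b) = n * Complex.I := by
    refine mul_left_cancel₀ (b := ω₁ (star u * b)) (Complex.ofReal_ne_zero.2 Real.two_pi_pos.ne') ?_
    rw [hn]
    push_cast
    ring
  refine ⟨-n, ?_⟩
  rw [index_eq h hu hb, hvalue]
  push_cast
  linear_combination (n : ℂ) * Complex.I_sq

theorem index_eq_zero_of_norm_lt (h : Admissible ρ ω₁ ω₂) (hlt : ‖ω₁ - ω₂‖ < 2) :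
    index ρ ω₁ ω₂ = 0 := by
  obtain ⟨u, b, hu, hb⟩ := h.exists_intertwines
  have h0 : ω₁ u ≠ 0 := fun h0 =>
    (hu.eq_compAd ▸ two_le_norm_sub_compAd h.comparable.1 hu.unitary h0).not_gt hlt
  have hphase (t : ℝ) : ω₁ (cocycle ρ u t) = 1 := by
    have hmul := apply_mul_cocycle h hu t u
    rw [cocycle, ← mul_assoc, Unitary.mul_star_self_of_mem hu.unitary, one_mul,
      h.invariant_left] at hmul
    exact (mul_eq_right₀ h0).1 hmul.symm
  have hderiv := hasDerivWithinAt_apply_cocycle ω₁ hb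
  simp only [hphase] at hderiv
  rw [index_eq h hu hb,
    (uniqueDiffWithinAt_Ioi 0).eq_deriv _ hderiv (hasDerivWithinAt_const 0 _ _), mul_zero]

end Phase

section Pullback

variable {A : Type*} [CStarAlgebra A] {ρ : AutFlow A} {ω ω₁ ω₂ : StrongDual ℂ A}
  {α : A ≃⋆ₐ[ℂ] A}

@[simp]
lemma pullback_apply (ω : StrongDual ℂ A) (α : A ≃⋆ₐ[ℂ] A) (a : A) : pullback ω α a = ω (α a) :=
  rfl

lemma pullback_mem_stateSpace (hω : ω ∈ stateSpace A) (α : A ≃⋆ₐ[ℂ] A) :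
    pullback ω α ∈ stateSpace A :=
  ⟨fun a => by rw [pullback_apply, map_mul, map_star]; exact hω.1 _,
    by rw [pullback_apply, map_one, hω.2]⟩

lemma pullback_mem_pureStates (hω : ω ∈ pureStates A) (α : A ≃⋆ₐ[ℂ] A) :
    pullback ω α ∈ pureStates A := by
  refine ⟨pullback_mem_stateSpace hω.1 α, fun φ hφ ψ hψ ⟨s, t, hs, ht, hst, hsum⟩ => ?_⟩
  have hφω : pullback φ α.symm = ω := by
    refine hω.2 (pullback_mem_stateSpace hφ _) (pullback_mem_stateSpace hψ α.symm)
      ⟨s, t, hs, ht, hst, ?_⟩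
    ext a
    simpa using DFunLike.congr_fun hsum (α.symm a)
  ext a
  simp [← hφω]

lemma CommutesWithGenerator.hasGenerator_apply (hα : CommutesWithGenerator ρ α) {a b : A}
    (h : ρ.HasGenerator a b) : ρ.HasGenerator (α a) (α b) := by
  rw [← h.generator_eq, hα.2 a h.mem_domain ((hα.1 a).2 h.mem_domain)]
  exact AutFlow.hasGenerator_generator _

lemma CommutesWithGenerator.hasGenerator_symm_apply (hα : CommutesWithGenerator ρ α) {a b : A}
    (h : ρ.HasGenerator a b) : ρ.HasGenerator (α.symm a) (α.symm b) := by
  have hmem : α.symm a ∈ ρ.generator.domain := (hα.1 _).1 (by simpa using h.mem_domain)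
  have hgen := AutFlow.hasGenerator_generator hmem
  have happly := hα.hasGenerator_apply hgen
  rw [StarAlgEquiv.apply_symm_apply] at happly
  rwa [← tendsto_nhds_unique happly h, StarAlgEquiv.symm_apply_apply]

lemma IsInvariant.pullback (hα : CommutesWithGenerator ρ α) (hω : IsInvariant ρ ω) :
    IsInvariant ρ (pullback ω α) :=
  isInvariant_iff.2 fun _ _ h => hω.apply_eq_zero (hα.hasGenerator_apply h)

lemma Intertwines.pullback (hα : CommutesWithGenerator ρ α) {u : A}
    (hu : Intertwines ρ ω₁ ω₂ u) :
    Intertwines ρ (pullback ω₁ α) (pullback ω₂ α) (α.symm u) where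
  unitary := Unitary.map_mem α.symm hu.unitary
  mem_domain :=
    (hα.hasGenerator_symm_apply (AutFlow.hasGenerator_generator hu.mem_domain)).mem_domain
  eq_comp a := by
    simp only [pullback_apply, hu.eq_comp, map_mul, map_star, StarAlgEquiv.apply_symm_apply]

lemma Admissible.pullback (hα : CommutesWithGenerator ρ α) (h : Admissible ρ ω₁ ω₂) :
    Admissible ρ (pullback ω₁ α) (pullback ω₂ α) := by
  obtain ⟨u, hu⟩ := h.comparable.2.2
  exact ⟨⟨pullback_mem_pureStates h.comparable.1 α, pullback_mem_pureStates h.comparable.2.1 α, _,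
    hu.pullback hα⟩, h.invariant_left.pullback hα, h.invariant_right.pullback hα⟩

lemma index_pullback (hα : CommutesWithGenerator ρ α) (h : Admissible ρ ω₁ ω₂) :
    index ρ (pullback ω₁ α) (pullback ω₂ α) = index ρ ω₁ ω₂ := by
  obtain ⟨u, b, hu, hb⟩ := h.exists_intertwines
  rw [index_eq (h.pullback hα) (hu.pullback hα) (hα.hasGenerator_symm_apply hb), index_eq h hu hb,
    pullback_apply, map_mul, map_star, StarAlgEquiv.apply_symm_apply,
    StarAlgEquiv.apply_symm_apply]

end Pullback

/-! ### Product states and product flows -/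

section Product

variable {A B C : Type*} [CStarAlgebra A] [CStarAlgebra B] [CStarAlgebra C]

/-- The embedding `a ↦ a ⊗ 1` of the left factor. -/
def leftLeg (j : A ⊗[ℂ] B →⋆ₐ[ℂ] C) : A →⋆ₐ[ℂ] C where
  __ := j.toAlgHom.comp Algebra.TensorProduct.includeLeft
  map_star' a := by
    change j (star a ⊗ₜ[ℂ] 1) = star (j (a ⊗ₜ[ℂ] 1))
    rw [← map_star, TensorProduct.star_tmul, star_one]

/-- The embedding `b ↦ 1 ⊗ b` of the right factor. -/
def rightLeg (j : A ⊗[ℂ] B →⋆ₐ[ℂ] C) : B →⋆ₐ[ℂ] C where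
  __ := j.toAlgHom.comp Algebra.TensorProduct.includeRight
  map_star' b := by
    change j (1 ⊗ₜ[ℂ] star b) = star (j (1 ⊗ₜ[ℂ] b))
    rw [← map_star, TensorProduct.star_tmul, star_one]

variable {j : A ⊗[ℂ] B →⋆ₐ[ℂ] C} {ω : StrongDual ℂ A} {ω' : StrongDual ℂ B}
  {F Ω : StrongDual ℂ C}

lemma leftLeg_apply (a : A) : leftLeg j a = j (a ⊗ₜ[ℂ] 1) := rfl

lemma rightLeg_apply (b : B) : rightLeg j b = j (1 ⊗ₜ[ℂ] b) := rfl

lemma map_tmul_mul (a a' : A) (b b' : B) :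
    j (a ⊗ₜ[ℂ] b) * j (a' ⊗ₜ[ℂ] b') = j ((a * a') ⊗ₜ[ℂ] (b * b')) := by
  rw [← map_mul, Algebra.TensorProduct.tmul_mul_tmul]

lemma leftLeg_mul_rightLeg (a : A) (b : B) : leftLeg j a * rightLeg j b = j (a ⊗ₜ[ℂ] b) := by
  rw [leftLeg_apply, rightLeg_apply, map_tmul_mul, mul_one, one_mul]

lemma star_map_tmul (a : A) (b : B) : star (j (a ⊗ₜ[ℂ] b)) = j (star a ⊗ₜ[ℂ] star b) := by
  rw [← map_star, TensorProduct.star_tmul]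

lemma map_one_tmul_one : j (1 ⊗ₜ[ℂ] 1) = 1 := by
  rw [← Algebra.TensorProduct.one_def, map_one]

lemma ext_of_tmul (hj : DenseRange j) {E : Type*} [TopologicalSpace E] [AddCommGroup E]
    [Module ℂ E] [T2Space E] {f g : C →L[ℂ] E}
    (h : ∀ a b, f (j (a ⊗ₜ[ℂ] b)) = g (j (a ⊗ₜ[ℂ] b))) : f = g := by
  refine DFunLike.coe_injective (hj.equalizer f.continuous g.continuous (funext fun x => ?_))
  induction x with
  | zero => simp only [Function.comp_apply, map_zero]
  | add x y hx hy => simpa only [Function.comp_apply, map_add] using congrArg₂ (· + ·) hx hy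
  | tmul a b => exact h a b

section Order

attribute [local instance 10] CStarAlgebra.spectralOrder CStarAlgebra.spectralOrderedRing

lemma linearMap_ext_star_mul_self {E : Type*} [AddCommMonoid E] [Module ℂ E] {f g : A →ₗ[ℂ] E}
    (h : ∀ y, f (star y * y) = g (star y * y)) : f = g := by
  refine LinearMap.ext_on CStarAlgebra.span_nonneg fun a (ha : 0 ≤ a) => ?_
  obtain ⟨y, rfl⟩ := CStarAlgebra.nonneg_iff_eq_star_mul_self.mp ha
  exact h y

end Order

lemma comap_compAd_rightLeg_apply (F : StrongDual ℂ C) (a : A) (y : B) :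
    comap (compAd F (rightLeg j y)) (leftLeg j) a = F (j (a ⊗ₜ[ℂ] (star y * y))) := by
  rw [comap_apply, compAd_apply, rightLeg_apply, leftLeg_apply, star_map_tmul, map_tmul_mul,
    map_tmul_mul, star_one, one_mul, mul_one, mul_one]

namespace IsProductState

lemma apply_one_tmul_of_isPositive_sub (hΩ : IsProductState j ω ω' Ω) (hω : ω 1 = 1)
    (hω' : ω' ∈ pureStates B) (hF : IsPositive F) {M : ℝ} (hM : IsPositive (M • Ω - F)) (b : B) :
    F (j (1 ⊗ₜ[ℂ] b)) = F 1 * ω' b := by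
  have hslice : comap Ω (rightLeg j) = ω' := by
    ext b
    rw [comap_apply, rightLeg_apply, hΩ.2, hω, one_mul]
  have hdom : IsPositive (M • ω' - comap F (rightLeg j)) := hslice ▸ hM.comap (rightLeg j)
  simpa only [comap_apply, rightLeg_apply, map_one_tmul_one, smul_apply, smul_eq_mul] using
    DFunLike.congr_fun (eq_smul_of_isPositive_sub hω' (hF.comap (rightLeg j)) hdom) b

lemma apply_tmul_star_mul_self_of_isPositive_sub (hΩ : IsProductState j ω ω' Ω)
    (hω : ω ∈ pureStates A) (hω' : IsPositive ω') (hF : IsPositive F) {M : ℝ}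
    (hM : IsPositive (M • Ω - F)) (a : A) (y : B) :
    F (j (a ⊗ₜ[ℂ] (star y * y))) = F (j (1 ⊗ₜ[ℂ] (star y * y))) * ω a := by
  let slice (G : StrongDual ℂ C) : StrongDual ℂ A := comap (compAd G (rightLeg j y)) (leftLeg j)
  obtain ⟨r, -, hr⟩ := (hω'.compAd y).exists_apply_one_eq
  rw [compAd_apply, mul_one] at hr
  have hslice : slice Ω = r • ω := by
    ext a
    rw [comap_compAd_rightLeg_apply, hΩ.2, hr, smul_apply, Complex.real_smul, mul_comm]
  have hdom : IsPositive ((M * r) • ω - slice F) := by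
    rw [mul_smul, ← hslice]
    exact (hM.compAd (rightLeg j y)).comap (leftLeg j)
  simpa only [slice, comap_compAd_rightLeg_apply, smul_apply, smul_eq_mul] using
    DFunLike.congr_fun
      (eq_smul_of_isPositive_sub hω ((hF.compAd (rightLeg j y)).comap (leftLeg j)) hdom) a

lemma apply_tmul_of_isPositive_sub (hΩ : IsProductState j ω ω' Ω) (hω : ω ∈ pureStates A)
    (hω' : ω' ∈ pureStates B) (hF : IsPositive F) {M : ℝ} (hM : IsPositive (M • Ω - F)) (a : A)
    (b : B) : F (j (a ⊗ₜ[ℂ] b)) = F 1 * (ω a * ω' b) := by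
  let slice : B →ₗ[ℂ] ℂ := F.toLinearMap ∘ₗ j.toAlgHom.toLinearMap ∘ₗ TensorProduct.mk ℂ A B a
  have hslice : slice = (F 1 * ω a) • ω'.toLinearMap := by
    refine linearMap_ext_star_mul_self fun y => ?_
    change F (j (a ⊗ₜ[ℂ] (star y * y))) = F 1 * ω a * ω' (star y * y)
    rw [hΩ.apply_tmul_star_mul_self_of_isPositive_sub hω hω'.1.1 hF hM,
      hΩ.apply_one_tmul_of_isPositive_sub hω.1.2 hω' hF hM]
    ring
  exact (DFunLike.congr_fun hslice b).trans (mul_assoc _ _ _)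

lemma mem_pureStates (hj : DenseRange j) (hω : ω ∈ pureStates A) (hω' : ω' ∈ pureStates B)
    (hΩ : IsProductState j ω ω' Ω) : Ω ∈ pureStates C := by
  refine ⟨hΩ.1, fun F hF G hG ⟨s, t, hs, ht, _, hsum⟩ => ?_⟩
  have hdom : IsPositive (s⁻¹ • Ω - F) := by
    have hG_eq : s⁻¹ • Ω - F = (s⁻¹ * t) • G := by
      rw [← hsum, smul_add, inv_smul_smul₀ hs.ne', add_sub_cancel_left, mul_smul]
    rw [hG_eq]
    exact (isPositive_of_mem_stateSpace hG).real_smul (by positivity)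
  refine ext_of_tmul hj fun a b => ?_
  rw [hΩ.apply_tmul_of_isPositive_sub hω hω' (isPositive_of_mem_stateSpace hF) hdom, hF.2,
    one_mul, hΩ.2]

lemma unique (hj : DenseRange j) (hF : IsProductState j ω ω' F) (hΩ : IsProductState j ω ω' Ω) :
    F = Ω :=
  ext_of_tmul hj fun a b => by rw [hF.2, hΩ.2]

end IsProductState

variable {ρ : AutFlow A} {ρ' : AutFlow B} {σ τ : AutFlow C}

namespace IsProductFlow

lemma unique (hj : DenseRange j) (hσ : IsProductFlow j ρ ρ' σ) (hτ : IsProductFlow j ρ ρ' τ) :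
    σ = τ :=
  AutFlow.ext_apply fun t => DFunLike.congr_fun
    (f := starHomCLM (σ.toFun t)) (g := starHomCLM (τ.toFun t))
    (ext_of_tmul hj fun a b => (hσ t a b).trans (hτ t a b).symm)

lemma hasGenerator_tmul (hσ : IsProductFlow j ρ ρ' σ) {a b : A} {a' b' : B}
    (h : ρ.HasGenerator a b) (h' : ρ'.HasGenerator a' b') :
    σ.HasGenerator (j (a ⊗ₜ[ℂ] a')) (j (b ⊗ₜ[ℂ] a') + j (a ⊗ₜ[ℂ] b')) := by
  have hleft : σ.HasGenerator (leftLeg j a) (leftLeg j b) := by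
    refine ((map_continuous (leftLeg j)).tendsto b |>.comp h).congr fun t => ?_
    rw [Function.comp_apply, map_smul, map_sub, leftLeg_apply, leftLeg_apply, hσ, map_one]
  have hright : σ.HasGenerator (rightLeg j a') (rightLeg j b') := by
    refine ((map_continuous (rightLeg j)).tendsto b' |>.comp h').congr fun t => ?_
    rw [Function.comp_apply, map_smul, map_sub, rightLeg_apply, rightLeg_apply, hσ, map_one]
  simpa only [leftLeg_mul_rightLeg] using hleft.mul hright

lemma isInvariant (hj : DenseRange j) (hσ : IsProductFlow j ρ ρ' σ) (hω : IsInvariant ρ ω)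
    (hω' : IsInvariant ρ' ω') (hΩ : IsProductState j ω ω' Ω) : IsInvariant σ Ω := fun t =>
  DFunLike.congr_fun (f := pullback Ω (σ.toFun t)) (ext_of_tmul hj fun a b => by
    rw [pullback_apply, hσ, hΩ.2, hΩ.2, hω, hω'])

end IsProductFlow

variable {ω₁ ω₂ : StrongDual ℂ A} {ω₁' ω₂' : StrongDual ℂ B} {Ω₁ Ω₂ : StrongDual ℂ C}

lemma Intertwines.tmul (hj : DenseRange j) (hσ : IsProductFlow j ρ ρ' σ) {u : A} {u' : B}
    (hu : Intertwines ρ ω₁ ω₂ u) (hu' : Intertwines ρ' ω₁' ω₂' u')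
    (h₁ : IsProductState j ω₁ ω₁' Ω₁) (h₂ : IsProductState j ω₂ ω₂' Ω₂) :
    Intertwines σ Ω₁ Ω₂ (j (u ⊗ₜ[ℂ] u')) where
  unitary := by
    rw [← leftLeg_mul_rightLeg]
    exact mul_mem (Unitary.map_mem (leftLeg j) hu.unitary)
      (Unitary.map_mem (rightLeg j) hu'.unitary)
  mem_domain := (hσ.hasGenerator_tmul (AutFlow.hasGenerator_generator hu.mem_domain)
    (AutFlow.hasGenerator_generator hu'.mem_domain)).mem_domain
  eq_comp := DFunLike.congr_fun (g := compAd Ω₁ (j (u ⊗ₜ[ℂ] u'))) (ext_of_tmul hj fun a b => by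
    rw [h₂.2, compAd_apply, star_map_tmul, map_tmul_mul, map_tmul_mul, h₁.2, hu.eq_comp,
      hu'.eq_comp])

lemma Admissible.tmul (hj : DenseRange j) (hσ : IsProductFlow j ρ ρ' σ)
    (h : Admissible ρ ω₁ ω₂) (h' : Admissible ρ' ω₁' ω₂')
    (h₁ : IsProductState j ω₁ ω₁' Ω₁) (h₂ : IsProductState j ω₂ ω₂' Ω₂) : Admissible σ Ω₁ Ω₂ := by
  obtain ⟨u, hu⟩ := h.comparable.2.2
  obtain ⟨u', hu'⟩ := h'.comparable.2.2
  exact ⟨⟨h₁.mem_pureStates hj h.comparable.1 h'.comparable.1,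
      h₂.mem_pureStates hj h.comparable.2.1 h'.comparable.2.1, _, .tmul hj hσ hu hu' h₁ h₂⟩,
    hσ.isInvariant hj h.invariant_left h'.invariant_left h₁,
    hσ.isInvariant hj h.invariant_right h'.invariant_right h₂⟩

lemma index_tmul (hj : DenseRange j) (hσ : IsProductFlow j ρ ρ' σ)
    (h : Admissible ρ ω₁ ω₂) (h' : Admissible ρ' ω₁' ω₂')
    (h₁ : IsProductState j ω₁ ω₁' Ω₁) (h₂ : IsProductState j ω₂ ω₂' Ω₂) :
    index σ Ω₁ Ω₂ = index ρ ω₁ ω₂ + index ρ' ω₁' ω₂' := by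
  obtain ⟨u, b, hu, hb⟩ := h.exists_intertwines
  obtain ⟨u', b', hu', hb'⟩ := h'.exists_intertwines
  rw [index_eq (.tmul hj hσ h h' h₁ h₂) (.tmul hj hσ hu hu' h₁ h₂) (hσ.hasGenerator_tmul hb hb'),
    index_eq h hu hb, index_eq h' hu' hb', mul_add, star_map_tmul, map_tmul_mul, map_tmul_mul,
    map_add, h₁.2, h₁.2, Unitary.star_mul_self_of_mem hu.unitary,
    Unitary.star_mul_self_of_mem hu'.unitary, h.comparable.1.1.2, h'.comparable.1.1.2]
  ring

end Product

/-! ### The spatial tensor product -/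

section StarExtend

variable {X C D : Type*} [Ring X] [Algebra ℂ X] [StarRing X] [CStarAlgebra C] [CStarAlgebra D]
  {j : X →⋆ₐ[ℂ] C} {k : X →⋆ₐ[ℂ] D}

lemma extendOfNorm_map_apply (hj : DenseRange j) (h : ∀ x, ‖k x‖ ≤ ‖j x‖) (x : X) :
    k.toAlgHom.toLinearMap.extendOfNorm j.toAlgHom.toLinearMap (j x) = k x :=
  LinearMap.extendOfNorm_eq (f := k.toAlgHom.toLinearMap) (e := j.toAlgHom.toLinearMap) hj
    ⟨1, fun x => (h x).trans_eq (one_mul _).symm⟩ x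

/-- The extension of `k` along a ⋆-homomorphism `j` of dense range such that `‖k x‖ ≤ ‖j x‖`. -/
def starExtend (hj : DenseRange j) (h : ∀ x, ‖k x‖ ≤ ‖j x‖) : C →⋆ₐ[ℂ] D :=
  let F : C →L[ℂ] D := k.toAlgHom.toLinearMap.extendOfNorm j.toAlgHom.toLinearMap
  have hF : ∀ x, F (j x) = k x := extendOfNorm_map_apply hj h
  { AlgHom.ofLinearMap F.toLinearMap
      (show F 1 = 1 by simpa only [map_one] using hF 1)
      (hj.induction_on₂ (p := fun x y => F (x * y) = F x * F y)
        (isClosed_eq (by fun_prop) (by fun_prop)) fun x y => by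
          rw [← map_mul, hF, hF, hF, map_mul]) with
    map_star' := fun x => hj.induction_on (p := fun x => F (star x) = star (F x)) x
      (isClosed_eq (by fun_prop) (by fun_prop)) fun x => by rw [← map_star, hF, hF, map_star] }

lemma starExtend_apply (hj : DenseRange j) (h : ∀ x, ‖k x‖ ≤ ‖j x‖) (x : X) :
    starExtend hj h (j x) = k x :=
  extendOfNorm_map_apply hj h x

end StarExtend

section CyclicVector

variable {H K : Type*} [NormedAddCommGroup H] [InnerProductSpace ℂ H] [CompleteSpace H]
  [NormedAddCommGroup K] [InnerProductSpace ℂ K] [CompleteSpace K]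

section Comparison

variable {X : Type*} [Semiring X] [Algebra ℂ X] [InvolutiveStar X] {π : X →⋆ₐ[ℂ] (H →L[ℂ] H)}
  {π' : X →⋆ₐ[ℂ] (K →L[ℂ] K)} {ξ : H} {η : K}

lemma norm_map_apply_eq_of_inner_eq (h : ∀ x, ⟪ξ, π x ξ⟫_ℂ = ⟪η, π' x η⟫_ℂ) (x : X) :
    ‖π x ξ‖ = ‖π' x η‖ := by
  have hinner : ⟪π x ξ, π x ξ⟫_ℂ = ⟪π' x η, π' x η⟫_ℂ := by
    rw [inner_map_left, inner_map_left, ← map_mul_apply, ← map_mul_apply, h]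
  rw [norm_eq_sqrt_re_inner (𝕜 := ℂ), hinner, ← norm_eq_sqrt_re_inner]

lemma norm_map_le_of_inner_eq (hξ : DenseRange fun x => π x ξ)
    (h : ∀ x, ⟪ξ, π x ξ⟫_ℂ = ⟪η, π' x η⟫_ℂ) (x : X) : ‖π x‖ ≤ ‖π' x‖ := by
  refine (π x).opNorm_le_bound (norm_nonneg _) fun v => ?_
  refine hξ.induction_on (p := fun v => ‖π x v‖ ≤ ‖π' x‖ * ‖v‖) v
    (isClosed_le (by fun_prop) (by fun_prop)) fun z => ?_
  rw [← map_mul_apply, norm_map_apply_eq_of_inner_eq h, norm_map_apply_eq_of_inner_eq h,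
    map_mul_apply]
  exact (π' x).le_opNorm _

end Comparison

variable {A B : Type*} [CStarAlgebra A] [CStarAlgebra B] {π : A →⋆ₐ[ℂ] (H →L[ℂ] H)}
  {π' : B →⋆ₐ[ℂ] (K →L[ℂ] K)} {ξ : H} {η : K}

lemma tensorRep_tmul_apply (a : A) (b : B) (x : H) (y : K) :
    tensorRep π π' (a ⊗ₜ[ℂ] b) (inclHT (x ⊗ₜ[ℂ] y)) = inclHT (π a x ⊗ₜ[ℂ] π' b y) := by
  rw [tensorRep_tmul, tensorOp_incl, TensorProduct.mapL_tmul]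

lemma denseRange_tensorRep (hξ : DenseRange fun a => π a ξ) (hη : DenseRange fun b => π' b η) :
    DenseRange fun x => tensorRep π π' x (inclHT (ξ ⊗ₜ[ℂ] η)) := by
  let orbit : Submodule ℂ (HilbertTensor H K) := LinearMap.range
    ((ContinuousLinearMap.apply ℂ (HilbertTensor H K) (inclHT (ξ ⊗ₜ[ℂ] η))).toLinearMap ∘ₗ
      (tensorRep π π').toAlgHom.toLinearMap)
  have hclosed : IsClosed (orbit.topologicalClosure : Set (HilbertTensor H K)) :=
    orbit.isClosed_topologicalClosure
  have tmul_mem (x : H) (y : K) : inclHT (x ⊗ₜ[ℂ] y) ∈ orbit.topologicalClosure := by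
    have hcont : Continuous fun z : H × K => (inclHT (z.1 ⊗ₜ[ℂ] z.2) : HilbertTensor H K) :=
      inclHT.continuous.comp (TensorProduct.continuous_tmul (𝕜 := ℂ))
    refine (hξ.prodMap hη).induction_on
      (p := fun z => inclHT (z.1 ⊗ₜ[ℂ] z.2) ∈ orbit.topologicalClosure) (x, y)
      (hclosed.preimage hcont) fun ⟨a, b⟩ => ?_
    exact orbit.le_topologicalClosure ⟨a ⊗ₜ[ℂ] b, tensorRep_tmul_apply a b ξ η⟩
  have incl_mem (z : H ⊗[ℂ] K) : inclHT z ∈ orbit.topologicalClosure := by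
    induction z with
    | zero => exact map_zero (inclHT (H := H) (K := K)) ▸ zero_mem _
    | add z z' hz hz' => exact map_add inclHT z z' ▸ add_mem hz hz'
    | tmul x y => exact tmul_mem x y
  exact fun z => denseRange_inclHT.induction_on (p := (· ∈ orbit.topologicalClosure)) z hclosed
    incl_mem

end CyclicVector

section SpatialProduct

variable {A B : Type*} [CStarAlgebra A] [CStarAlgebra B]

/-- The ⋆-homomorphism `α ⊗ β` of the algebraic tensor product. -/
def tensorMap (α : A ≃⋆ₐ[ℂ] A) (β : B ≃⋆ₐ[ℂ] B) : A ⊗[ℂ] B →⋆ₐ[ℂ] A ⊗[ℂ] B where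
  __ := Algebra.TensorProduct.map α.toStarAlgHom.toAlgHom β.toStarAlgHom.toAlgHom
  map_star' x := by
    change TensorProduct.map _ _ (star x) = star (TensorProduct.map _ _ x)
    induction x with
    | zero => rw [star_zero, map_zero, star_zero]
    | add x y hx hy => rw [star_add, map_add, map_add, star_add, hx, hy]
    | tmul a b =>
      rw [TensorProduct.star_tmul, TensorProduct.map_tmul, TensorProduct.map_tmul,
        TensorProduct.star_tmul]
      exact congrArg₂ (· ⊗ₜ[ℂ] ·) (map_star α a) (map_star β b)

@[simp]
lemma tensorMap_tmul (α : A ≃⋆ₐ[ℂ] A) (β : B ≃⋆ₐ[ℂ] B) (a : A) (b : B) :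
    tensorMap α β (a ⊗ₜ[ℂ] b) = α a ⊗ₜ[ℂ] β b :=
  rfl

lemma tensorMap_surjective (α : A ≃⋆ₐ[ℂ] A) (β : B ≃⋆ₐ[ℂ] B) :
    Function.Surjective (tensorMap α β) :=
  TensorProduct.map_surjective α.surjective β.surjective

/-- The vector `Ω_φ ⊗ Ω_ψ`, cyclic for `π_φ ⊗ π_ψ`, which represents the product state. -/
def prodVector (p : stateSpace A × stateSpace B) : prodSpace p :=
  inclHT (gnsVector p.1 ⊗ₜ[ℂ] gnsVector p.2)

lemma denseRange_prodRep (p : stateSpace A × stateSpace B) :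
    DenseRange fun x => prodRep p x (prodVector p) :=
  denseRange_tensorRep (denseRange_gnsRep p.1) (denseRange_gnsRep p.2)

lemma inner_prodVector_prodRep_tmul (p : stateSpace A × stateSpace B) (a : A) (b : B) :
    ⟪prodVector p, prodRep p (a ⊗ₜ[ℂ] b) (prodVector p)⟫_ℂ = p.1.1 a * p.2.1 b := by
  rw [prodRep, prodVector, tensorRep_tmul_apply, LinearIsometry.inner_map_map,
    TensorProduct.inner_tmul, inner_gnsVector_gnsRep, inner_gnsVector_gnsRep]

/-- The pair of states `(φ ∘ α, ψ ∘ β)`. -/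
def pullbackPair (p : stateSpace A × stateSpace B) (α : A ≃⋆ₐ[ℂ] A) (β : B ≃⋆ₐ[ℂ] B) :
    stateSpace A × stateSpace B :=
  (⟨_, pullback_mem_stateSpace p.1.2 α⟩, ⟨_, pullback_mem_stateSpace p.2.2 β⟩)

lemma inner_prodVector_prodRep_tensorMap (p : stateSpace A × stateSpace B) (α : A ≃⋆ₐ[ℂ] A)
    (β : B ≃⋆ₐ[ℂ] B) (x : A ⊗[ℂ] B) :
    ⟪prodVector p, prodRep p (tensorMap α β x) (prodVector p)⟫_ℂ =
      ⟪prodVector (pullbackPair p α β),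
        prodRep (pullbackPair p α β) x (prodVector (pullbackPair p α β))⟫_ℂ := by
  induction x with
  | zero => simp only [map_zero, zero_apply, inner_zero_right]
  | add x y hx hy => simp only [map_add, add_apply, inner_add_right, hx, hy]
  | tmul a b =>
    rw [tensorMap_tmul, inner_prodVector_prodRep_tmul, inner_prodVector_prodRep_tmul]
    rfl

lemma norm_prodRep_tensorMap_le (p : stateSpace A × stateSpace B) (α : A ≃⋆ₐ[ℂ] A)
    (β : B ≃⋆ₐ[ℂ] B) (x : A ⊗[ℂ] B) :
    ‖prodRep p (tensorMap α β x)‖ ≤ ‖prodRep (pullbackPair p α β) x‖ := by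
  have hdense : DenseRange ((fun x => prodRep p x (prodVector p)) ∘ tensorMap α β) := by
    rw [DenseRange, (tensorMap_surjective α β).range_comp]
    exact denseRange_prodRep p
  exact norm_map_le_of_inner_eq (π := (prodRep p).comp (tensorMap α β)) hdense
    (inner_prodVector_prodRep_tensorMap p α β) x

/-- The representation of the spatial tensor product on its summand `H_φ ⊗ H_ψ`. -/
def spatialRep (p : stateSpace A × stateSpace B) :
    SpatialTensor A B →⋆ₐ[ℂ] (prodSpace p →L[ℂ] prodSpace p) where
  toFun T := T.1 p
  map_one' := rfl
  map_mul' _ _ := rfl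
  map_zero' := rfl
  map_add' _ _ := rfl
  commutes' _ := rfl
  map_star' _ := rfl

lemma spatialRep_spatialEmb (p : stateSpace A × stateSpace B) (x : A ⊗[ℂ] B) :
    spatialRep p (spatialEmb A B x) = prodRep p x :=
  rfl

lemma norm_spatialEmb_tensorMap_le (α : A ≃⋆ₐ[ℂ] A) (β : B ≃⋆ₐ[ℂ] B) (x : A ⊗[ℂ] B) :
    ‖spatialEmb A B (tensorMap α β x)‖ ≤ ‖spatialEmb A B x‖ :=
  lp.norm_le_of_forall_le (norm_nonneg _) fun p =>
    (norm_prodRep_tensorMap_le p α β x).trans <| by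
      rw [← spatialRep_spatialEmb]
      exact NonUnitalStarAlgHom.norm_apply_le _ _

variable (A B) in
lemma denseRange_spatialEmb : DenseRange (spatialEmb A B) := by
  refine fun x => Metric.mem_closure_iff.2 fun ε hε => ?_
  obtain ⟨_, ⟨y, rfl⟩, hy⟩ := Metric.mem_closure_iff.1 (x.2 : x.1 ∈ closure _) ε hε
  exact ⟨_, ⟨y, rfl⟩, hy⟩

/-- The ⋆-homomorphism `α ⊗ β` of the spatial tensor product. -/
def spatialMap (α : A ≃⋆ₐ[ℂ] A) (β : B ≃⋆ₐ[ℂ] B) : SpatialTensor A B →⋆ₐ[ℂ] SpatialTensor A B :=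
  starExtend (denseRange_spatialEmb A B) (k := (spatialEmb A B).comp (tensorMap α β))
    (norm_spatialEmb_tensorMap_le α β)

lemma spatialMap_tmul (α : A ≃⋆ₐ[ℂ] A) (β : B ≃⋆ₐ[ℂ] B) (a : A) (b : B) :
    spatialMap α β (spatialEmb A B (a ⊗ₜ[ℂ] b)) = spatialEmb A B (α a ⊗ₜ[ℂ] β b) :=
  starExtend_apply _ _ _

lemma starAlgHom_ext_of_tmul {C D : Type*} [CStarAlgebra C] [CStarAlgebra D]
    {j : A ⊗[ℂ] B →⋆ₐ[ℂ] C} (hj : DenseRange j) {F G : C →⋆ₐ[ℂ] D}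
    (h : ∀ a b, F (j (a ⊗ₜ[ℂ] b)) = G (j (a ⊗ₜ[ℂ] b))) : F = G :=
  StarAlgHom.ext (DFunLike.congr_fun (f := starHomCLM F) (g := starHomCLM G) (ext_of_tmul hj h))

variable (ρ : AutFlow A) (ρ' : AutFlow B)

lemma spatialMap_comp (s t : ℝ) :
    (spatialMap (ρ.toFun s) (ρ'.toFun s)).comp (spatialMap (ρ.toFun t) (ρ'.toFun t)) =
      spatialMap (ρ.toFun (s + t)) (ρ'.toFun (s + t)) :=
  starAlgHom_ext_of_tmul (denseRange_spatialEmb A B) fun a b => by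
    rw [StarAlgHom.comp_apply, spatialMap_tmul, spatialMap_tmul, spatialMap_tmul, ρ.map_add,
      ρ'.map_add]

lemma spatialMap_zero : spatialMap (ρ.toFun 0) (ρ'.toFun 0) = StarAlgHom.id ℂ _ :=
  starAlgHom_ext_of_tmul (denseRange_spatialEmb A B) fun a b => by
    rw [spatialMap_tmul, ρ.map_zero, ρ'.map_zero, StarAlgHom.coe_id, id]

lemma continuous_spatialMap_spatialEmb (x : A ⊗[ℂ] B) :
    Continuous fun t => spatialMap (ρ.toFun t) (ρ'.toFun t) (spatialEmb A B x) := by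
  induction x with
  | zero => simpa only [map_zero] using continuous_const
  | add x y hx hy =>
    simp only [map_add]
    exact hx.add hy
  | tmul a b =>
    simp only [spatialMap_tmul]
    simp only [← leftLeg_mul_rightLeg]
    exact ((starHomCLM (leftLeg (spatialEmb A B))).continuous.comp (ρ.continuous a)).mul
      ((starHomCLM (rightLeg (spatialEmb A B))).continuous.comp (ρ'.continuous b))

lemma continuous_spatialMap (x : SpatialTensor A B) :
    Continuous fun t => spatialMap (ρ.toFun t) (ρ'.toFun t) x := by
  refine continuous_of_uniform_approx_of_continuous fun U hU => ?_
  obtain ⟨ε, hε, hεU⟩ := Metric.mem_uniformity_dist.1 hU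
  obtain ⟨y, hy⟩ := (denseRange_spatialEmb A B).exists_dist_lt x hε
  refine ⟨_, continuous_spatialMap_spatialEmb ρ ρ' y, fun t => hεU ?_⟩
  rw [dist_eq_norm] at hy ⊢
  rw [← map_sub]
  exact (NonUnitalStarAlgHom.norm_apply_le _ _).trans_lt hy

/-- The product flow on the spatial tensor product. -/
def spatialFlow : AutFlow (SpatialTensor A B) where
  toFun t := StarAlgEquiv.ofStarAlgHom (spatialMap (ρ.toFun t) (ρ'.toFun t))
    (spatialMap (ρ.toFun (-t)) (ρ'.toFun (-t)))
    (by rw [spatialMap_comp, neg_add_cancel, spatialMap_zero])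
    (by rw [spatialMap_comp, add_neg_cancel, spatialMap_zero])
  map_zero := DFunLike.congr_fun (spatialMap_zero ρ ρ')
  map_add s t x := (DFunLike.congr_fun (spatialMap_comp ρ ρ' s t) x).symm
  continuous := continuous_spatialMap ρ ρ'

lemma isProductFlow_spatialFlow : IsProductFlow (spatialEmb A B) ρ ρ' (spatialFlow ρ ρ') :=
  fun _ => spatialMap_tmul _ _

/-- The product state on the spatial tensor product. -/
def spatialState (p : stateSpace A × stateSpace B) : StrongDual ℂ (SpatialTensor A B) :=
  matrixCoeff (spatialRep p) (prodVector p) (prodVector p)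

lemma spatialState_tmul (p : stateSpace A × stateSpace B) (a : A) (b : B) :
    spatialState p (spatialEmb A B (a ⊗ₜ[ℂ] b)) = p.1.1 a * p.2.1 b :=
  inner_prodVector_prodRep_tmul p a b

lemma isProductState_spatialState (p : stateSpace A × stateSpace B) :
    IsProductState (spatialEmb A B) p.1 p.2 (spatialState p) := by
  refine ⟨⟨?_, ?_⟩, spatialState_tmul p⟩
  · exact isPositive_matrixCoeff_apply zero_le_one (fun _ => Commute.one_left _) _
  · rw [← map_one_tmul_one (j := spatialEmb A B), spatialState_tmul, p.1.2.2, p.2.2.2, one_mul]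

variable {ρ ρ'}

lemma existsUnique_isProductFlow : ∃! σ, IsProductFlow (spatialEmb A B) ρ ρ' σ :=
  ⟨_, isProductFlow_spatialFlow ρ ρ',
    fun _ hσ => hσ.unique (denseRange_spatialEmb A B) (isProductFlow_spatialFlow ρ ρ')⟩

lemma existsUnique_isProductState {ω : StrongDual ℂ A} {ω' : StrongDual ℂ B}
    (hω : ω ∈ stateSpace A) (hω' : ω' ∈ stateSpace B) :
    ∃! Ω, IsProductState (spatialEmb A B) ω ω' Ω :=
  ⟨_, isProductState_spatialState (⟨ω, hω⟩, ⟨ω', hω'⟩), fun _ hΩ =>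
    hΩ.unique (denseRange_spatialEmb A B) (isProductState_spatialState (⟨ω, hω⟩, ⟨ω', hω'⟩))⟩

end SpatialProduct

end ChargeIndex

end

theorem mainTheorem2 {A : Type u} [CStarAlgebra A] (ρ : ChargeIndex.AutFlow A) :
    -- independence of the choice of the intertwining unitary
    (∀ ω₁ ω₂ : StrongDual ℂ A, ChargeIndex.Admissible ρ ω₁ ω₂ →
      ∀ (u : A) (hu : ChargeIndex.Intertwines ρ ω₁ ω₂ u),
        ChargeIndex.index ρ ω₁ ω₂ =
          Complex.I * ω₁ (star u * ρ.generator ⟨u, hu.mem_domain⟩)) ∧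
    -- integrality
    ((∀ a : A, ρ.toFun (2 * Real.pi) a = a) →
      ∀ ω₁ ω₂ : StrongDual ℂ A, ChargeIndex.Admissible ρ ω₁ ω₂ →
        ∃ n : ℤ, ChargeIndex.index ρ ω₁ ω₂ = n) ∧
    -- continuity
    (∀ ω₁ ω₂ : StrongDual ℂ A, ChargeIndex.Admissible ρ ω₁ ω₂ →
      ‖ω₁ - ω₂‖ < 2 → ChargeIndex.index ρ ω₁ ω₂ = 0) ∧
    -- invariance under automorphisms commuting with the generator
    (∀ α : A ≃⋆ₐ[ℂ] A, ChargeIndex.CommutesWithGenerator ρ α →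
      ∀ ω₁ ω₂ : StrongDual ℂ A, ChargeIndex.Admissible ρ ω₁ ω₂ →
        ChargeIndex.Admissible ρ (ChargeIndex.pullback ω₁ α) (ChargeIndex.pullback ω₂ α) ∧
        ChargeIndex.index ρ (ChargeIndex.pullback ω₁ α) (ChargeIndex.pullback ω₂ α) =
          ChargeIndex.index ρ ω₁ ω₂) ∧
    -- vanishing on the diagonal
    (∀ ω ∈ ChargeIndex.pureStates A, ChargeIndex.IsInvariant ρ ω →
      ChargeIndex.Admissible ρ ω ω ∧ ChargeIndex.index ρ ω ω = 0) ∧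
    -- additivity
    (∀ ω₁ ω₂ ω₃ : StrongDual ℂ A,
      ChargeIndex.Admissible ρ ω₁ ω₂ → ChargeIndex.Admissible ρ ω₂ ω₃ →
        ChargeIndex.Admissible ρ ω₁ ω₃ ∧
        ChargeIndex.index ρ ω₁ ω₂ + ChargeIndex.index ρ ω₂ ω₃ = ChargeIndex.index ρ ω₁ ω₃) ∧
    -- antisymmetry
    (∀ ω₁ ω₂ : StrongDual ℂ A, ChargeIndex.Admissible ρ ω₁ ω₂ →
      ChargeIndex.Admissible ρ ω₂ ω₁ ∧
      ChargeIndex.index ρ ω₁ ω₂ = -ChargeIndex.index ρ ω₂ ω₁) ∧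
    -- additivity under tensor products
    (∀ (B : Type v) [CStarAlgebra B] (ρ' : ChargeIndex.AutFlow B),
      -- for every C⋆-tensor product on which the product flow and the product states exist
      (∀ (C : Type w) [CStarAlgebra C] (j : A ⊗[ℂ] B →⋆ₐ[ℂ] C), DenseRange j →
        ∀ σ : ChargeIndex.AutFlow C, ChargeIndex.IsProductFlow j ρ ρ' σ →
        ∀ (ω₁ ω₂ : StrongDual ℂ A) (ω₁' ω₂' : StrongDual ℂ B) (Ω₁ Ω₂ : StrongDual ℂ C),
          ChargeIndex.Admissible ρ ω₁ ω₂ → ChargeIndex.Admissible ρ' ω₁' ω₂' →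
          ChargeIndex.IsProductState j ω₁ ω₁' Ω₁ → ChargeIndex.IsProductState j ω₂ ω₂' Ω₂ →
            ChargeIndex.Admissible σ Ω₁ Ω₂ ∧
            ChargeIndex.index σ Ω₁ Ω₂ =
              ChargeIndex.index ρ ω₁ ω₂ + ChargeIndex.index ρ' ω₁' ω₂') ∧
      -- in particular for the spatial tensor product, where they always exist and are unique
      DenseRange (ChargeIndex.spatialEmb A B) ∧
      (∃! σ : ChargeIndex.AutFlow (ChargeIndex.SpatialTensor A B),
        ChargeIndex.IsProductFlow (ChargeIndex.spatialEmb A B) ρ ρ' σ) ∧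
      (∀ ω ∈ ChargeIndex.stateSpace A, ∀ ω' ∈ ChargeIndex.stateSpace B,
        ∃! Ω : StrongDual ℂ (ChargeIndex.SpatialTensor A B),
          ChargeIndex.IsProductState (ChargeIndex.spatialEmb A B) ω ω' Ω) ∧
      (∀ σ : ChargeIndex.AutFlow (ChargeIndex.SpatialTensor A B),
        ChargeIndex.IsProductFlow (ChargeIndex.spatialEmb A B) ρ ρ' σ →
        ∀ (ω₁ ω₂ : StrongDual ℂ A) (ω₁' ω₂' : StrongDual ℂ B)
          (Ω₁ Ω₂ : StrongDual ℂ (ChargeIndex.SpatialTensor A B)),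
          ChargeIndex.Admissible ρ ω₁ ω₂ → ChargeIndex.Admissible ρ' ω₁' ω₂' →
          ChargeIndex.IsProductState (ChargeIndex.spatialEmb A B) ω₁ ω₁' Ω₁ →
          ChargeIndex.IsProductState (ChargeIndex.spatialEmb A B) ω₂ ω₂' Ω₂ →
            ChargeIndex.Admissible σ Ω₁ Ω₂ ∧
            ChargeIndex.index σ Ω₁ Ω₂ =
              ChargeIndex.index ρ ω₁ ω₂ + ChargeIndex.index ρ' ω₁' ω₂')) := by
  open ChargeIndex in
  refine ⟨fun _ _ h _ hu => index_eq h hu (AutFlow.hasGenerator_generator hu.mem_domain),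
    fun hρ _ _ h => exists_index_eq_intCast hρ h,
    fun _ _ h hlt => index_eq_zero_of_norm_lt h hlt,
    fun _ hα _ _ h => ⟨h.pullback hα, index_pullback hα h⟩,
    fun _ hω hinv => ⟨.refl hω hinv, index_self hω hinv⟩,
    fun _ _ _ h h' => ⟨h.trans h', index_add h h'⟩,
    fun _ _ h => ⟨h.symm, index_symm h⟩,
    fun B _ ρ' => ⟨fun _ _ _ hj _ hσ _ _ _ _ _ _ h h' h₁ h₂ =>
        ⟨.tmul hj hσ h h' h₁ h₂, index_tmul hj hσ h h' h₁ h₂⟩,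
      denseRange_spatialEmb A B, existsUnique_isProductFlow,
      fun _ hω _ hω' => existsUnique_isProductState hω hω',
      fun _ hσ _ _ _ _ _ _ h h' h₁ h₂ =>
        have hj := denseRange_spatialEmb A B
        ⟨.tmul hj hσ h h' h₁ h₂, index_tmul hj hσ h h' h₁ h₂⟩⟩⟩
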